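/- **Theorem 3.1.** Let $m,k,l$ be integers with $m\ge 2$, $1\le k\le l$ and $\gcd(m,k,l)=1$, and let $f(x,y,z)=z^m-x^ky^l$ on $\mathbf C^3$. Let $0<\alpha\le\varepsilon$ be real numbers with $\alpha^{k+l}<\varepsilon^m$, let $B=\{|x|\le\alpha,\ |y|\le\alpha,\ |z|\le\varepsilon\}$, and let $t\in\mathbf C$ satisfy $0<|t|<\min(\alpha^{k+l},\,\varepsilon^m-\alpha^{k+l})$. Let $F_t=B\cap f^{-1}(t)$ be the Milnor fiber and $L=F_t\cap\partial B$ its boundary. Then $L\subset\{|x|=\alpha\}\cup\{|y|=\alpha\}$, and $L$ is a Seifert manifold whose leaves are the connected components of the level sets $L\cap\{z=c\}$, $c\in\mathbf C$; in particular the projection to the $z$-axis is constant on each leaf. Here a *Seifert manifold* is a closed connected oriented smooth 3-manifold partitioned into circles (the leaves) such that each leaf is the core $\{0\}\times S^1$ of an embedded open fibred solid torus: an open set which is a union of leaves and is diffeomorphic, by a diffeomorphism that preserves orientation and carries leaves to leaves, to $\{w\in\mathbf C:|w|<1\}\times S^1$ foliated by the orbits of $u\cdot(w,v)=(u^qw,u^pv)$,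 $u\in S^1$, for some coprime integers $p\ge1$ and $q$. The smooth structure on $L$ is one which is compatible with its topology and which, off the corner $\{|x|=|y|=\alpha\}$, is the structure induced from $\mathbf C^3$. -/

import Mathlib

open scoped ContDiff Topology

/-- The leaf through `P` of the standard open fibred solid torus of type `(p, q)`: the solid torus
`{|w| < 1} × S¹` is foliated by the orbits of the circle action `u • (w, v) = (u ^ q w, u ^ p v)`.
The core `{0} × S¹` is a leaf, and following the leaves once around the `S¹`-factor turns
the meridian disc by `q / p` of a full turn. -/
def modelLeaf (p : ℕ) (q : ℤ) (P : ℂ × Circle) : Set (ℂ × Circle) :=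
  Set.range fun u : Circle => (((u ^ q : Circle) : ℂ) * P.1, u ^ p * P.2)

/-- The universal covering `(w, θ) ↦ (w, e^{iθ})`, used to do calculus on the solid torus. -/
noncomputable def torusLift (Q : ℂ × ℝ) : ℂ × Circle :=
  (Q.1, Circle.exp Q.2)

/-- `φ` is a fibred solid torus in `X` for the partition `leaves`: an open embedding of the open
solid torus `{|w| < 1} × S¹` carrying the leaves of a standard fibred solid torus of some type
`(p, q)`, with `p ≥ 1` and `gcd (p, q) = 1`, to members of `leaves`. -/
def IsFibredSolidTorus {X : Type*} [TopologicalSpace X] (leaves : Set (Set X))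
    (φ : OpenPartialHomeomorph (ℂ × Circle) X) : Prop :=
  φ.source = Metric.ball (0 : ℂ) 1 ×ˢ Set.univ ∧
    ∃ (p : ℕ) (q : ℤ), 1 ≤ p ∧ IsCoprime (p : ℤ) q ∧
      ∀ P ∈ φ.source, φ '' modelLeaf p q P ∈ leaves

/-- The change of coordinates from `φ` to `ψ` is smooth with positive Jacobian determinant. It is
read in the angular coordinates `(w, θ)`: wherever the two images meet, it is given locally by a
smooth map `g` of `ℂ × ℝ` with `0 < det Dg`. -/
def OrientedSmoothCompatible {X : Type*} [TopologicalSpace X]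
    (φ ψ : OpenPartialHomeomorph (ℂ × Circle) X) : Prop :=
  ∀ P P' : ℂ × ℝ, torusLift P ∈ φ.source → torusLift P' ∈ ψ.source →
    φ (torusLift P) = ψ (torusLift P') →
      ∃ g : ℂ × ℝ → ℂ × ℝ, g P = P' ∧ ContDiffAt ℝ ∞ g P ∧ 0 < (fderiv ℝ g P).det ∧
        ∀ᶠ Q in 𝓝 P, φ (torusLift Q) = ψ (torusLift (g Q))

/-- A Seifert structure on `X`: `X` is a closed connected oriented smooth 3-manifold partitioned
into circles, the leaves, each of which is the core of a fibred solid torus. The smooth structure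
and the orientation are those for which the tubes in `tubes`, which cover `X`, form an
oriented smooth atlas. -/
structure SeifertStructure (X : Type*) [TopologicalSpace X] where
  /-- the Seifert leaves -/
  leaves : Set (Set X)
  /-- the fibred tubular neighbourhoods of the leaves -/
  tubes : Set (OpenPartialHomeomorph (ℂ × Circle) X)
  compact : CompactSpace X
  hausdorff : T2Space X
  connected : ConnectedSpace X
  partition : Setoid.IsPartition leaves
  fibred : ∀ φ ∈ tubes, IsFibredSolidTorus leaves φ
  core : ∀ F ∈ leaves, ∃ φ ∈ tubes, φ '' ({(0 : ℂ)} ×ˢ Set.univ) = F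
  compatible : ∀ φ ∈ tubes, ∀ ψ ∈ tubes, OrientedSmoothCompatible φ ψ

/-- The function `f (x, y, z) = z ^ m - x ^ k * y ^ l`. -/
def hirzebruchFun (m k l : ℕ) (P : ℂ × ℂ × ℂ) : ℂ :=
  P.2.2 ^ m - P.1 ^ k * P.2.1 ^ l

/-- The closed polydisc `{|x| ≤ α, |y| ≤ α, |z| ≤ ε}`. -/
def polydisc (α ε : ℝ) : Set (ℂ × ℂ × ℂ) :=
  Metric.closedBall 0 α ×ˢ Metric.closedBall 0 α ×ˢ Metric.closedBall 0 ε

/-- The fibre `F_t` of `f` over `t` in the polydisc. -/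
def milnorFibre (m k l : ℕ) (α ε : ℝ) (t : ℂ) : Set (ℂ × ℂ × ℂ) :=
  polydisc α ε ∩ hirzebruchFun m k l ⁻¹' {t}

/-- The boundary `L_t` of the fibre: its intersection with the boundary of the polydisc. -/
def milnorBoundary (m k l : ℕ) (α ε : ℝ) (t : ℂ) : Set (ℂ × ℂ × ℂ) :=
  milnorFibre m k l α ε t ∩ frontier (polydisc α ε)

/-- The level set of the projection to the `z`-axis through `P`, in a subspace `L` of `ℂ³`. -/
def zLevel {L : Set (ℂ × ℂ × ℂ)} (P : L) : Set L :=
  {Q : L | Q.1.2.2 = P.1.2.2}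

/-!
The boundary of the Milnor fibre is the set `link` of points with `z ^ m = t + x ^ k * y ^ l` and
`max |x| |y| = α`; the face `|z| = ε` of the polydisc is not met. With `g = gcd (k, l)`,
`p = l / g`, `q = k / g`, the circle acts on it by `u • (x, y, z) = (u ^ p x, u ^ (-q) y, z)`,
and the leaves are the orbits. On a level set of `z` the product `x ^ k * y ^ l` is fixed, so that
`|x|` and `x ^ q * y ^ p` take finitely many values there; as they separate the orbits in the
level set, the orbits are its connected components (`connectedComponentIn_zLevel`).

The link is covered by three kinds of tubes. Around the leaves `y = 0` the variable `z` is a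
branch of the `m`-th root of `t + x ^ k * y ^ l`, and `(x, y)` are coordinates, which gives a tube
of type `(p, -q)` (`exists_exceptional_tube`). Around the other leaves with `|y| < α` the space of
leaves has the coordinate `z`, also at the branch points `z = 0` (`exists_side_tube`). Around the
leaves on the corner torus `|x| = |y| = α`, where `z ≠ 0`, it has the coordinates `log |y / x|` and
`arg (x ^ k * y ^ l)` (`exists_corner_tube`). The side `|x| < α` is obtained by exchanging `x`
and `y`, an operation under which everything is symmetric, orientations included: each side is
oriented as part of the boundary of the complex surface `f = t`.

To avoid comparing the tubes pairwise, the atlas consists of all fibred solid tori which are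
`IsAdapted`: at each point of the link one fixed local coordinate is chosen, linear in the
coordinates of `ℂ³` off the corner, and a tube is adapted if it is smooth with positive Jacobian
determinant in these coordinates. Two such tubes are compatible by the inverse function theorem
(`exists_transition`). On the sides the tubes map meridian discs holomorphically into the curves
`x = const` while `arg x` increases, so the determinant is positive (`det_sideFrame_pos`).

The link is connected because `z` can be continued along paths of `y` leading to the corner torus
(`exists_preconnected`), and this torus is connected: its points are parametrized by the
arguments `a`, `b` of `x` and `y`, since `gcd (m, k, l) = 1` allows one to choose
these with `k a + l b` equal to `m` times the argument of a root of `x ^ k * y ^ l`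
(`range_torusParam`).
-/

namespace HirzebruchLink

/-! ### Determinants and compatibility of charts -/

theorem det_prod_complex_real (A : ℂ × ℝ →L[ℝ] ℂ × ℝ) :
    A.det = Matrix.det !![(A (1, 0)).1.re, (A (Complex.I, 0)).1.re, (A (0, 1)).1.re;
      (A (1, 0)).1.im, (A (Complex.I, 0)).1.im, (A (0, 1)).1.im;
      (A (1, 0)).2, (A (Complex.I, 0)).2, (A (0, 1)).2] := by
  let b : Module.Basis (Fin 2 ⊕ Unit) ℝ (ℂ × ℝ) :=
    Complex.basisOneI.prod (Module.Basis.singleton Unit ℝ)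
  let e : Fin 2 ⊕ Unit ≃ Fin 3 :=
    (Equiv.sumCongr (Equiv.refl (Fin 2)) (Equiv.ofUnique Unit (Fin 1))).trans finSumFinEquiv
  let b' := b.reindex e
  rw [ContinuousLinearMap.det, ← LinearMap.det_toMatrix b']
  congr 1
  have h0 : b' 0 = (1, 0) := by
    have : e.symm 0 = Sum.inl 0 := by rw [Equiv.symm_apply_eq]; rfl
    simp [b', this, b]
  have h1 : b' 1 = (Complex.I, 0) := by
    have : e.symm 1 = Sum.inl 1 := by rw [Equiv.symm_apply_eq]; rfl
    simp [b', this, b]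
  have h2 : b' 2 = (0, 1) := by
    have : e.symm 2 = Sum.inr () := by rw [Equiv.symm_apply_eq]; rfl
    simp [b', this, b]
  have r0 : ∀ v, b'.repr v 0 = v.1.re := by
    have : e.symm 0 = Sum.inl 0 := by rw [Equiv.symm_apply_eq]; rfl
    intro v; simp [b', this, b]
  have r1 : ∀ v, b'.repr v 1 = v.1.im := by
    have : e.symm 1 = Sum.inl 1 := by rw [Equiv.symm_apply_eq]; rfl
    intro v; simp [b', this, b]
  have r2 : ∀ v, b'.repr v 2 = v.2 := by
    have : e.symm 2 = Sum.inr () := by rw [Equiv.symm_apply_eq]; rfl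
    intro v; simp [b', this, b]
  ext i j
  rw [LinearMap.toMatrix_apply]
  fin_cases i <;> fin_cases j <;> simp [h0, h1, h2, r0, r1, r2]

theorem det_pos_of_complex_slice (A : ℂ × ℝ →L[ℝ] ℂ × ℝ) {a : ℂ} {n : ℝ} (ha : a ≠ 0)
    (hn : 0 < n) (h : ∀ w : ℂ, A (w, 0) = (a * w, 0)) (h' : (A (0, 1)).2 = n) : 0 < A.det := by
  rw [det_prod_complex_real, Matrix.det_fin_three]
  simp only [h, h']
  have : 0 < a.re * a.re + a.im * a.im := by
    have := Complex.normSq_pos.2 ha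
    rwa [Complex.normSq_apply] at this
  simp
  nlinarith [mul_pos this hn]

theorem isOpenMap_torusLift : IsOpenMap torusLift :=
  IsOpenMap.id.prodMap isLocalHomeomorph_circleExp.isOpenMap

theorem continuous_torusLift : Continuous torusLift :=
  continuous_id.prodMap Circle.exp.continuous

/-- Two tubes change coordinates smoothly and orientedly near a common point as soon as one and the
same map `κ` to `ℂ × ℝ`, which need not even be continuous, is a smooth
local coordinate with positive Jacobian determinant in both of them. -/
theorem exists_transition {X : Type*} [TopologicalSpace X]
    {φ ψ : OpenPartialHomeomorph (ℂ × Circle) X} {P P' : ℂ × ℝ}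
    (hP : torusLift P ∈ φ.source) (hP' : torusLift P' ∈ ψ.source)
    (h : φ (torusLift P) = ψ (torusLift P')) (κ : X → ℂ × ℝ)
    (hφ : ContDiffAt ℝ ∞ (fun Q => κ (φ (torusLift Q))) P)
    (hφd : 0 < (fderiv ℝ (fun Q => κ (φ (torusLift Q))) P).det)
    (hψ : ContDiffAt ℝ ∞ (fun Q => κ (ψ (torusLift Q))) P')
    (hψd : 0 < (fderiv ℝ (fun Q => κ (ψ (torusLift Q))) P').det) :
    ∃ g : ℂ × ℝ → ℂ × ℝ, g P = P' ∧ ContDiffAt ℝ ∞ g P ∧ 0 < (fderiv ℝ g P).det ∧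
      ∀ᶠ Q in 𝓝 P, φ (torusLift Q) = ψ (torusLift (g Q)) := by
  set f1 := fun Q => κ (φ (torusLift Q)) with hf1
  set f2 := fun Q => κ (ψ (torusLift Q)) with hf2
  have hf12 : f1 P = f2 P' := by simp [hf1, hf2, h]
  have hn : (∞ : WithTop ℕ∞) ≠ 0 := by simp
  let D := ContinuousLinearMap.toContinuousLinearEquivOfDetNeZero (fderiv ℝ f2 P') hψd.ne'
  have hD : HasFDerivAt f2 (D : ℂ × ℝ →L[ℝ] ℂ × ℝ) P' := by
    simpa [D] using (hψ.differentiableAt hn).hasFDerivAt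
  let e := hψ.toOpenPartialHomeomorph f2 hD hn
  have he : P' ∈ e.source := hψ.mem_toOpenPartialHomeomorph_source hD hn
  have heq : ∀ Q, e Q = f2 Q := fun _ => rfl
  have hs : e.symm (f1 P) = P' := by rw [hf12, ← heq]; exact e.left_inv he
  have hsm : ContDiffAt ℝ ∞ e.symm (f1 P) := by
    rw [hf12]; exact hψ.to_localInverse hD hn
  have hg : ContDiffAt ℝ ∞ (fun Q => e.symm (f1 Q)) P := hsm.comp P hφ
  refine ⟨fun Q => e.symm (f1 Q), hs, hg, ?_, ?_⟩
  · have hfe : f1 =ᶠ[𝓝 P] fun Q => f2 (e.symm (f1 Q)) := by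
      have : ∀ᶠ Q in 𝓝 P, f1 Q ∈ e.target := by
        refine hφ.continuousAt.eventually (e.open_target.mem_nhds ?_)
        rw [hf12]; exact e.map_source he
      filter_upwards [this] with Q hQ
      exact (e.right_inv hQ).symm
    have hd := hfe.fderiv_eq (𝕜 := ℝ)
    have hd2 : fderiv ℝ (fun Q => f2 (e.symm (f1 Q))) P
        = (fderiv ℝ f2 P').comp (fderiv ℝ (fun Q => e.symm (f1 Q)) P) := by
      have h2 : HasFDerivAt f2 (fderiv ℝ f2 P') (e.symm (f1 P)) := by
        rw [hs]; exact (hψ.differentiableAt hn).hasFDerivAt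
      exact (h2.comp P (hg.differentiableAt hn).hasFDerivAt).fderiv
    have hdet : (fderiv ℝ f1 P).det =
        (fderiv ℝ f2 P').det * (fderiv ℝ (fun Q => e.symm (f1 Q)) P).det := by
      rw [hd, hd2]
      exact LinearMap.det_comp (fderiv ℝ f2 P' : ℂ × ℝ →ₗ[ℝ] ℂ × ℝ)
        (fderiv ℝ (fun Q => e.symm (f1 Q)) P : ℂ × ℝ →ₗ[ℝ] ℂ × ℝ)
    rw [hdet] at hφd
    exact (pos_iff_pos_of_mul_pos hφd).1 hψd
  · have hnb : torusLift '' e.source ∈ 𝓝 (torusLift P') :=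
      (isOpenMap_torusLift _ e.open_source).mem_nhds ⟨P', he, rfl⟩
    have hc : ContinuousAt (fun Q => ψ.symm (φ (torusLift Q))) P := by
      refine ContinuousAt.comp (g := ψ.symm) ?_
        ((φ.continuousAt hP).comp continuous_torusLift.continuousAt)
      refine ψ.continuousAt_symm ?_
      simpa [h] using ψ.map_source hP'
    have h1 : ∀ᶠ Q in 𝓝 P, ψ.symm (φ (torusLift Q)) ∈ torusLift '' e.source := by
      refine hc.eventually ?_
      simp only [h, ψ.left_inv hP']
      exact hnb
    have h2 : ∀ᶠ Q in 𝓝 P, φ (torusLift Q) ∈ ψ.target := by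
      refine ((φ.continuousAt hP).comp continuous_torusLift.continuousAt).eventually ?_
      refine ψ.open_target.mem_nhds ?_
      simpa [h] using ψ.map_source hP'
    filter_upwards [h1, h2] with Q ⟨Q', hQ', hQQ⟩ hQ2
    have h3 : ψ (torusLift Q') = φ (torusLift Q) := by rw [hQQ, ψ.right_inv hQ2]
    have h4 : f1 Q = e Q' := by simp only [hf1, heq, hf2, h3]
    rw [h4, e.left_inv hQ', h3]

/-! ### Branches of roots -/

/-- The branch of the `n`-th root with `rootBranch n (c ^ n) = c`; it is analytic where
`v / c ^ n` avoids the negative real axis. -/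
noncomputable def rootBranch (n : ℕ) (c v : ℂ) : ℂ := c * (v / c ^ n) ^ ((n : ℂ)⁻¹)

/-- The open sector `|arg w| < π / n`, on which the principal branch inverts `w ↦ w ^ n`. -/
def sector (n : ℕ) : Set ℂ := {w | w ∈ Complex.slitPlane ∧ |w.arg| < Real.pi / n}

theorem rootBranch_pow {n : ℕ} (hn : n ≠ 0) {c : ℂ} (hc : c ≠ 0) (v : ℂ) :
    rootBranch n c v ^ n = v := by
  rw [rootBranch, mul_pow, Complex.cpow_nat_inv_pow _ hn, mul_div_cancel₀ _ (pow_ne_zero n hc)]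

theorem rootBranch_self (n : ℕ) {c : ℂ} (hc : c ≠ 0) : rootBranch n c (c ^ n) = c := by
  simp [rootBranch, div_self (pow_ne_zero n hc)]

theorem rootBranch_eq {n : ℕ} (hn : n ≠ 0) {c z : ℂ} (hc : c ≠ 0) (hz : z / c ∈ sector n) :
    rootBranch n c (z ^ n) = z := by
  obtain ⟨-, h⟩ := hz
  rw [abs_lt] at h
  rw [rootBranch, ← div_pow, Complex.pow_cpow_nat_inv hn h.1 h.2.le, mul_div_cancel₀ _ hc]

theorem rootBranch_mem_sector {n : ℕ} (hn : n ≠ 0) {c v : ℂ} (hc : c ≠ 0)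
    (hv : v / c ^ n ∈ Complex.slitPlane) : rootBranch n c v / c ∈ sector n := by
  have hn' : (0:ℝ) < n := by positivity
  rw [rootBranch, mul_div_cancel_left₀ _ hc]
  set w := v / c ^ n
  have hw : w ≠ 0 := Complex.slitPlane_ne_zero hv
  have hi : (Complex.log w * (n : ℂ)⁻¹).im = w.arg / n := by
    rw [← Complex.ofReal_natCast, ← Complex.ofReal_inv, Complex.im_mul_ofReal, Complex.log_im]
    rfl
  have h1 : |w.arg| < Real.pi := by
    rw [abs_lt]
    exact ⟨Complex.neg_pi_lt_arg w, lt_of_le_of_ne (Complex.arg_le_pi w)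
      (Complex.mem_slitPlane_iff_arg.1 hv).1⟩
  have hb : |w.arg / n| < Real.pi / n := by
    rw [abs_div, Nat.abs_cast]; gcongr
  have hle : Real.pi / n ≤ Real.pi :=
    div_le_self Real.pi_pos.le (by exact_mod_cast Nat.one_le_iff_ne_zero.2 hn)
  have hb' := abs_lt.1 hb
  have harg : (w ^ ((n:ℂ)⁻¹)).arg = w.arg / n := by
    rw [Complex.cpow_def_of_ne_zero hw, Complex.arg_exp, hi, toIocMod_eq_self]
    constructor <;> linarith
  refine ⟨?_, by rw [harg]; exact hb⟩
  rw [Complex.mem_slitPlane_iff_arg, harg]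
  refine ⟨by linarith [hb'.2], ?_⟩
  simp [Complex.cpow_eq_zero_iff, hw]

theorem isOpen_sector (n : ℕ) : IsOpen (sector n) := by
  have : ContinuousOn (fun w : ℂ => |w.arg|) Complex.slitPlane := fun w hw =>
    (Complex.continuousAt_arg hw).abs.continuousWithinAt
  exact this.isOpen_inter_preimage Complex.isOpen_slitPlane isOpen_Iio

theorem contDiffAt_rootBranch (n : ℕ) {c v : ℂ} (hv : v / c ^ n ∈ Complex.slitPlane) :
    ContDiffAt ℂ ∞ (rootBranch n c) v := by
  unfold rootBranch
  refine contDiffAt_const.mul ?_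
  have h1 : ContDiffAt ℂ ∞ (fun v : ℂ => v / c ^ n) v := contDiffAt_id.div_const _
  have h2 : AnalyticAt ℂ (fun w : ℂ => w ^ ((n:ℂ)⁻¹)) (v / c ^ n) :=
    AnalyticAt.cpow analyticAt_id analyticAt_const hv
  exact h2.contDiffAt.comp v h1

theorem rootBranch_ne_zero {n : ℕ} (hn : n ≠ 0) {c v : ℂ} (hc : c ≠ 0) (hv : v ≠ 0) :
    rootBranch n c v ≠ 0 := by
  intro h
  have := rootBranch_pow hn hc v
  rw [h, zero_pow hn] at this
  exact hv this.symm

theorem contDiffAt_rootBranch_comp {𝕜 E : Type*} [RCLike 𝕜] [NormedAlgebra 𝕜 ℂ]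
    [NormedAddCommGroup E] [NormedSpace 𝕜 E] (n : ℕ) (c : ℂ) {f : E → ℂ} {x : E}
    (hf : ContDiffAt 𝕜 ∞ f x) (hv : f x / c ^ n ∈ Complex.slitPlane) :
    ContDiffAt 𝕜 ∞ (fun y => rootBranch n c (f y)) x :=
  ((contDiffAt_rootBranch n hv).restrict_scalars 𝕜).comp x hf

attribute [irreducible] rootBranch

/-! ### The unit circle -/

/-- A unit complex number as a point of the circle; in general, the point with the argument of `z`. -/
noncomputable def toCircle (z : ℂ) : Circle := Circle.exp z.arg

theorem coe_toCircle {z : ℂ} (h : ‖z‖ = 1) : (toCircle z : ℂ) = z := by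
  have := Complex.norm_mul_exp_arg_mul_I z
  rwa [h, Complex.ofReal_one, one_mul] at this

theorem toCircle_coe (u : Circle) : toCircle u = u := Circle.ext (coe_toCircle u.norm_coe)

theorem continuousOn_toCircle {X : Type*} [TopologicalSpace X] {f : X → ℂ} {s : Set X}
    (hf : ContinuousOn f s) (h : ∀ x ∈ s, ‖f x‖ = 1) : ContinuousOn (fun x => toCircle (f x)) s := by
  have : Topology.IsInducing (fun u : Circle => (u : ℂ)) := ⟨rfl⟩
  rw [this.continuousOn_iff]
  exact hf.congr fun x hx => coe_toCircle (h x hx)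

theorem exists_pow_eq_circle {n : ℕ} (hn : n ≠ 0) (v : Circle) : ∃ u : Circle, u ^ n = v := by
  refine ⟨Circle.exp ((v : ℂ).arg / n), ?_⟩
  rw [← Circle.exp_natCast_mul, mul_div_cancel₀ _ (by exact_mod_cast hn), Circle.exp_arg]

theorem modelLeaf_core {p : ℕ} (hp : p ≠ 0) (q : ℤ) (v : Circle) :
    modelLeaf p q (0, v) = {(0 : ℂ)} ×ˢ Set.univ := by
  ext ⟨w, v'⟩
  simp only [modelLeaf, mul_zero, Set.mem_range, Prod.mk.injEq, Set.mem_prod, Set.mem_singleton_iff,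
    Set.mem_univ, and_true, exists_and_left]
  constructor
  · rintro ⟨h, -⟩; exact h.symm
  · intro h
    obtain ⟨u, hu⟩ := exists_pow_eq_circle hp (v' * v⁻¹)
    exact ⟨h.symm, u, by rw [hu]; simp⟩

/-! ### The link and its circle action -/

/-- The data of the singularity `z ^ m = x ^ k * y ^ l` and of its smoothing, with
`k = g * q`, `l = g * p`, `g = gcd (k, l)`. The order of `k` and `l` is left open, so that the data
are stable under exchanging `x` and `y`. -/
structure Params where
  /-- the exponent of `z` -/
  m : ℕ
  /-- the exponent of `x` -/
  k : ℕ
  /-- the exponent of `y` -/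
  l : ℕ
  /-- the greatest common divisor of `k` and `l` -/
  g : ℕ
  /-- the quotient `l / g` -/
  p : ℕ
  /-- the quotient `k / g` -/
  q : ℕ
  /-- the radius of the polydisc in the `x`- and `y`-directions -/
  α : ℝ
  /-- the value over which the Milnor fibre lies -/
  t : ℂ
  hm : 2 ≤ m
  hg : g ≠ 0
  hp : p ≠ 0
  hq : q ≠ 0
  hk : k = g * q
  hl : l = g * p
  hpq : Nat.Coprime p q
  hgcd : Nat.Coprime m g
  hα : 0 < α
  ht0 : t ≠ 0
  ht : ‖t‖ < α ^ (k + l)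

namespace Params

variable (D : Params)

theorem m_ne_zero : D.m ≠ 0 := by have := D.hm; omega
theorem k_ne_zero : D.k ≠ 0 := by rw [D.hk]; exact mul_ne_zero D.hg D.hq
theorem l_ne_zero : D.l ≠ 0 := by rw [D.hl]; exact mul_ne_zero D.hg D.hp
theorem kp_eq : D.k * D.p = D.l * D.q := by rw [D.hk, D.hl]; ring

/-- The data with the roles of `x` and `y` exchanged. -/
def swap : Params where
  m := D.m
  k := D.l
  l := D.k
  g := D.g
  p := D.q
  q := D.p
  α := D.α
  t := D.t
  hm := D.hm
  hg := D.hg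
  hp := D.hq
  hq := D.hp
  hk := D.hl
  hl := D.hk
  hpq := D.hpq.symm
  hgcd := D.hgcd
  hα := D.hα
  ht0 := D.ht0
  ht := by rw [add_comm]; exact D.ht

/-- The boundary of the Milnor fibre, described without reference to the polydisc. -/
def link : Set (ℂ × ℂ × ℂ) :=
  {P | P.2.2 ^ D.m = D.t + P.1 ^ D.k * P.2.1 ^ D.l ∧ max ‖P.1‖ ‖P.2.1‖ = D.α}

/-- The exchange of `x` and `y` on `ℂ³`. -/
def flip (P : ℂ × ℂ × ℂ) : ℂ × ℂ × ℂ := (P.2.1, P.1, P.2.2)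

theorem continuous_flip : Continuous flip := by unfold flip; fun_prop

theorem flip_mem {P : ℂ × ℂ × ℂ} (h : P ∈ D.link) : flip P ∈ D.swap.link := by
  refine ⟨?_, ?_⟩
  · simp only [flip, swap]; rw [h.1, mul_comm]
  · simp only [flip, swap]; rw [max_comm]; exact h.2

/-- The exchange of `x` and `y` as a homeomorphism between the links. -/
def flipHomeo : D.swap.link ≃ₜ D.link where
  toFun P := ⟨flip P.1, D.swap.flip_mem P.2⟩
  invFun P := ⟨flip P.1, D.flip_mem P.2⟩
  left_inv _ := rfl
  right_inv _ := rfl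
  continuous_toFun := (continuous_flip.comp continuous_subtype_val).subtype_mk _
  continuous_invFun := (continuous_flip.comp continuous_subtype_val).subtype_mk _

/-- The circle action on `ℂ³` whose orbits are the leaves of the link. -/
noncomputable def spin (u : Circle) (P : ℂ × ℂ × ℂ) : ℂ × ℂ × ℂ :=
  (((u ^ D.p : Circle) : ℂ) * P.1, (((u ^ D.q)⁻¹ : Circle) : ℂ) * P.2.1, P.2.2)

theorem spin_spin (u v : Circle) (P : ℂ × ℂ × ℂ) :
    D.spin u (D.spin v P) = D.spin (u * v) P := by
  simp only [spin, mul_pow, mul_inv, Circle.coe_mul, mul_assoc]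

theorem spin_one (P : ℂ × ℂ × ℂ) : D.spin 1 P = P := by simp [spin]

theorem circle_pow_mul (u : Circle) : (u ^ D.p) ^ D.k * ((u ^ D.q)⁻¹) ^ D.l = 1 := by
  rw [inv_pow, ← pow_mul, ← pow_mul, mul_comm D.p, mul_comm D.q, D.kp_eq, mul_inv_cancel]

theorem spin_pow_mul (u : Circle) (P : ℂ × ℂ × ℂ) :
    (D.spin u P).1 ^ D.k * (D.spin u P).2.1 ^ D.l = P.1 ^ D.k * P.2.1 ^ D.l := by
  have h := congrArg ((↑) : Circle → ℂ) (D.circle_pow_mul u)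
  rw [Circle.coe_mul, Circle.coe_pow _ D.k, Circle.coe_pow _ D.l, Circle.coe_one] at h
  simp only [spin, mul_pow]
  linear_combination (P.1 ^ D.k * P.2.1 ^ D.l) * h

theorem norm_spin_fst (u : Circle) (P : ℂ × ℂ × ℂ) : ‖(D.spin u P).1‖ = ‖P.1‖ := by
  rw [spin, norm_mul, Circle.norm_coe, one_mul]

theorem norm_spin_snd (u : Circle) (P : ℂ × ℂ × ℂ) : ‖(D.spin u P).2.1‖ = ‖P.2.1‖ := by
  simp only [spin]
  rw [norm_mul, Circle.norm_coe, one_mul]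

theorem spin_mem (u : Circle) {P : ℂ × ℂ × ℂ} (h : P ∈ D.link) : D.spin u P ∈ D.link := by
  refine ⟨?_, ?_⟩
  · rw [D.spin_pow_mul]; exact h.1
  · rw [D.norm_spin_fst, D.norm_spin_snd]; exact h.2

theorem continuous_circle_coe : Continuous fun u : Circle => (u : ℂ) :=
  continuous_subtype_val

theorem continuous_spin (P : ℂ × ℂ × ℂ) : Continuous fun u => D.spin u P := by
  unfold spin
  have h1 : Continuous fun u : Circle => ((u ^ D.p : Circle) : ℂ) :=
    continuous_circle_coe.comp (continuous_pow D.p)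
  have h2 : Continuous fun u : Circle => (((u ^ D.q)⁻¹ : Circle) : ℂ) :=
    continuous_circle_coe.comp (continuous_pow D.q).inv
  fun_prop

/-- The orbit of a point of the link under the circle action. -/
def orbit (P : D.link) : Set D.link := {Q | ∃ u : Circle, Q.1 = D.spin u P.1}

theorem mem_orbit_self (P : D.link) : P ∈ D.orbit P := ⟨1, (D.spin_one P.1).symm⟩

theorem orbit_eq_of_mem {P Q : D.link} (h : Q ∈ D.orbit P) : D.orbit Q = D.orbit P := by
  obtain ⟨u, hu⟩ := h
  ext R
  constructor
  · rintro ⟨v, hv⟩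
    exact ⟨v * u, by rw [hv, hu, spin_spin]⟩
  · rintro ⟨v, hv⟩
    exact ⟨v * u⁻¹, by rw [hv, hu, spin_spin]; simp⟩

theorem isPreconnected_orbit (P : D.link) : IsPreconnected (D.orbit P) := by
  have : D.orbit P = Set.range fun u : Circle => (⟨D.spin u P.1, D.spin_mem u P.2⟩ : D.link) := by
    ext Q
    simp only [orbit, Set.mem_ofPred_eq, Set.mem_range, Subtype.ext_iff]
    exact exists_congr fun u => eq_comm
  rw [this]
  exact isPreconnected_range ((D.continuous_spin P.1).subtype_mk _)

theorem isPartition_orbits : Setoid.IsPartition (Set.range D.orbit) := by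
  refine ⟨?_, fun P => ⟨D.orbit P, ⟨⟨P, rfl⟩, D.mem_orbit_self P⟩, ?_⟩⟩
  · rintro ⟨P, hP⟩
    exact (hP ▸ D.mem_orbit_self P : P ∈ (∅ : Set D.link))
  · rintro F ⟨⟨Q, rfl⟩, hQ⟩
    exact (D.orbit_eq_of_mem hQ).symm

/-- On the torus `X ^ q * Y ^ p = 1`, a Bézout relation for `p` and `q` inverts the
parametrization `u ↦ (u ^ p, u ^ (-q))`. -/
theorem bezout_param {G : Type*} [CommGroup G] {p q : ℕ} {a b : ℤ} (hab : p * a + q * b = 1)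
    {X Y : G} (h : X ^ q * Y ^ p = 1) :
    (X ^ a * Y ^ (-b)) ^ p = X ∧ ((X ^ a * Y ^ (-b)) ^ q)⁻¹ = Y := by
  have hY : Y ^ (p : ℤ) = X ^ (-(q : ℤ)) := by
    rw [zpow_neg, zpow_natCast, zpow_natCast]
    exact eq_inv_of_mul_eq_one_right h
  have hX : X ^ (q : ℤ) = Y ^ (-(p : ℤ)) := by
    rw [zpow_neg, zpow_natCast, zpow_natCast]
    exact eq_inv_of_mul_eq_one_left h
  constructor
  · rw [← zpow_natCast, mul_zpow, ← zpow_mul, ← zpow_mul, mul_comm (-b), zpow_mul Y, hY,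
      ← zpow_mul, ← zpow_add]
    convert zpow_one X using 2
    linear_combination hab
  · rw [← zpow_natCast, mul_zpow, ← zpow_mul, ← zpow_mul, mul_comm a, zpow_mul X, hX,
      ← zpow_mul, ← zpow_add, ← zpow_neg]
    convert zpow_one Y using 2
    linear_combination hab

theorem bezout_param_left {G : Type*} [CommGroup G] {p q : ℕ} {a b : ℤ}
    (hab : p * a + q * b = 1) (u : G) : (u ^ p) ^ a * ((u ^ q)⁻¹) ^ (-b) = u := by
  rw [← zpow_natCast, ← zpow_natCast, ← zpow_neg, ← zpow_mul, ← zpow_mul, ← zpow_add]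
  convert zpow_one u using 2
  linear_combination hab

theorem exists_bezout : ∃ a b : ℤ, (D.p : ℤ) * a + D.q * b = 1 := by
  have h := Nat.gcd_eq_gcd_ab D.p D.q
  rw [D.hpq.gcd_eq_one] at h
  exact ⟨_, _, by exact_mod_cast h.symm⟩

theorem norm_fst_le {P : ℂ × ℂ × ℂ} (h : P ∈ D.link) : ‖P.1‖ ≤ D.α := h.2 ▸ le_max_left _ _
theorem norm_snd_le {P : ℂ × ℂ × ℂ} (h : P ∈ D.link) : ‖P.2.1‖ ≤ D.α := h.2 ▸ le_max_right _ _

theorem norm_eq_or {P : ℂ × ℂ × ℂ} (h : P ∈ D.link) : ‖P.1‖ = D.α ∨ ‖P.2.1‖ = D.α := by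
  rcases max_choice ‖P.1‖ ‖P.2.1‖ with h' | h'
  · left; rw [← h', h.2]
  · right; rw [← h', h.2]

theorem norm_fst_of_lt {P : ℂ × ℂ × ℂ} (h : P ∈ D.link) (h' : ‖P.2.1‖ < D.α) : ‖P.1‖ = D.α :=
  (D.norm_eq_or h).resolve_right h'.ne

theorem exists_circle_mul {x y : ℂ} (h : ‖x‖ = ‖y‖) : ∃ u : Circle, x = u * y := by
  rcases eq_or_ne y 0 with rfl | hy
  · exact ⟨1, by simpa using h⟩
  · refine ⟨toCircle (x / y), ?_⟩
    rw [coe_toCircle, div_mul_cancel₀ _ hy]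
    rw [norm_div, h, div_self (norm_ne_zero_iff.2 hy)]

/-- The functions `z`, `|x|` and `x ^ q * y ^ p` separate the orbits. -/
theorem mem_orbit_of_eq {P Q : D.link} (hz : Q.1.2.2 = P.1.2.2) (hx : ‖Q.1.1‖ = ‖P.1.1‖)
    (hxy : Q.1.1 ^ D.q * Q.1.2.1 ^ D.p = P.1.1 ^ D.q * P.1.2.1 ^ D.p) : Q ∈ D.orbit P := by
  obtain ⟨⟨x, y, z⟩, hP⟩ := P
  obtain ⟨⟨x', y', z'⟩, hQ⟩ := Q
  simp only at hz hx hxy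
  subst hz
  rcases eq_or_ne x 0 with rfl | hx0
  · have hx' : x' = 0 := by simpa using hx
    subst hx'
    have h1 : ‖y‖ = D.α := (D.norm_eq_or hP).resolve_left (by simpa using D.hα.ne)
    have h2 : ‖y'‖ = D.α := (D.norm_eq_or hQ).resolve_left (by simpa using D.hα.ne)
    obtain ⟨v, hv⟩ := exists_circle_mul (h2.trans h1.symm)
    obtain ⟨u, hu⟩ := exists_pow_eq_circle D.hq v⁻¹
    refine ⟨u, ?_⟩
    simp [spin, hu, ← hv]
  have hx0' : x' ≠ 0 := by rw [← norm_ne_zero_iff, hx, norm_ne_zero_iff]; exact hx0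
  rcases eq_or_ne y 0 with rfl | hy0
  · have hy' : y' = 0 := by
      simpa [zero_pow D.hp, hx0', D.hp, D.hq] using hxy
    subst hy'
    obtain ⟨v, hv⟩ := exists_circle_mul hx
    obtain ⟨u, hu⟩ := exists_pow_eq_circle D.hp v
    refine ⟨u, ?_⟩
    simp [spin, hu, ← hv]
  have hy : ‖y'‖ = ‖y‖ := by
    have := congrArg norm hxy
    rw [norm_mul, norm_mul, norm_pow, norm_pow, norm_pow, norm_pow, hx] at this
    exact (pow_left_inj₀ (norm_nonneg _) (norm_nonneg _) D.hp).1
      (mul_left_cancel₀ (pow_ne_zero _ (norm_ne_zero_iff.2 hx0)) this)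
  obtain ⟨X, hX⟩ := exists_circle_mul hx
  obtain ⟨Y, hY⟩ := exists_circle_mul hy
  have hXY : X ^ D.q * Y ^ D.p = 1 := by
    apply Circle.ext
    rw [hX, hY] at hxy
    have : x ^ D.q * y ^ D.p ≠ 0 := mul_ne_zero (pow_ne_zero _ hx0) (pow_ne_zero _ hy0)
    apply mul_right_cancel₀ this
    push_cast
    linear_combination hxy
  obtain ⟨a, b, hab⟩ := D.exists_bezout
  obtain ⟨h1, h2⟩ := bezout_param hab hXY
  exact ⟨_, by simp only [spin]; rw [h1, h2, ← hX, ← hY]⟩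

theorem finite_pow_eq {K : Type*} [CommRing K] [IsDomain K] {n : ℕ} (hn : n ≠ 0) (a : K) :
    {w : K | w ^ n = a}.Finite := by
  classical
  refine (Polynomial.nthRoots n a).toFinset.finite_toSet.subset fun w hw => ?_
  simpa [Polynomial.mem_nthRoots (Nat.pos_of_ne_zero hn)] using hw

/-- The orbits are the connected components of the level sets of `z`: on such a
level set the invariants `|x|` and `x ^ q * y ^ p` take only finitely many values. -/
theorem connectedComponentIn_zLevel (P : D.link) :
    connectedComponentIn (zLevel P) P = D.orbit P := by
  have hPz : P ∈ zLevel P := rfl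
  refine Set.Subset.antisymm (fun Q hQ => ?_) ?_
  · set s := P.1.1 ^ D.k * P.1.2.1 ^ D.l with hs
    have hsQ : ∀ R ∈ zLevel P, R.1.1 ^ D.k * R.1.2.1 ^ D.l = s := fun R hR => by
      have h1 := R.2.1
      have h2 := P.2.1
      rw [show R.1.2.2 = P.1.2.2 from hR, h2] at h1
      exact (add_left_cancel h1).symm
    let f : D.link → ℝ × ℂ := fun R => (‖R.1.1‖, R.1.1 ^ D.q * R.1.2.1 ^ D.p)
    have hf : Continuous f := by fun_prop
    let T : Set (ℝ × ℂ) :=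
      ({D.α} ∪ {r : ℝ | r ^ D.k = ‖s‖ / D.α ^ D.l}) ×ˢ {w : ℂ | w ^ D.g = s}
    have hT : T.Finite :=
      ((Set.finite_singleton _).union (finite_pow_eq D.k_ne_zero _)).prod (finite_pow_eq D.hg _)
    have hm : Set.MapsTo f (connectedComponentIn (zLevel P) P) T := by
      intro R hR
      have hR' := hsQ R (connectedComponentIn_subset _ _ hR)
      refine ⟨?_, ?_⟩
      · rcases D.norm_eq_or R.2 with h | h
        · exact Or.inl h
        · right
          simp only [f, Set.mem_ofPred_eq, ← hR', norm_mul, norm_pow, h]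
          rw [mul_div_cancel_right₀ _ (pow_ne_zero _ D.hα.ne')]
      · simp only [f, Set.mem_ofPred_eq, ← hR']
        rw [mul_pow, ← pow_mul, ← pow_mul, mul_comm D.q, mul_comm D.p, ← D.hk, ← D.hl]
    obtain ⟨c, hc, hfc⟩ := isPreconnected_connectedComponentIn.eqOn_const_of_mapsTo
      hT.isDiscrete hf.continuousOn hm ⟨f P, hm (mem_connectedComponentIn hPz)⟩
    have hfQ : f Q = f P := (hfc hQ).trans (hfc (mem_connectedComponentIn hPz)).symm
    exact D.mem_orbit_of_eq (show Q ∈ zLevel P from connectedComponentIn_subset _ _ hQ) (congrArg Prod.fst hfQ)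
      (congrArg Prod.snd hfQ)
  · refine (D.isPreconnected_orbit P).subset_connectedComponentIn (D.mem_orbit_self P) ?_
    rintro Q ⟨u, hu⟩
    change Q.1.2.2 = P.1.2.2
    rw [hu]; rfl

/-! ### Connectedness of the link -/

/-- The corner torus of the link. -/
def cornerTorus : Set (ℂ × ℂ × ℂ) := {P ∈ D.link | ‖P.1‖ = D.α ∧ ‖P.2.1‖ = D.α}

theorem norm_pow_mul_of_corner {x y : ℂ} (hx : ‖x‖ = D.α) (hy : ‖y‖ = D.α) :
    ‖x ^ D.k * y ^ D.l‖ = D.α ^ (D.k + D.l) := by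
  rw [norm_mul, norm_pow, norm_pow, hx, hy, pow_add]

theorem norm_pow_mul_le {P : ℂ × ℂ × ℂ} (h : P ∈ D.link) :
    ‖P.1 ^ D.k * P.2.1 ^ D.l‖ ≤ D.α ^ (D.k + D.l) := by
  rw [norm_mul, norm_pow, norm_pow, pow_add]
  have := D.norm_fst_le h
  have := D.norm_snd_le h
  have := D.hα.le
  gcongr

theorem one_add_mem_slitPlane {w : ℂ} (h : ‖w‖ < 1) : 1 + w ∈ Complex.slitPlane :=
  Complex.mem_slitPlane_of_norm_lt_one h

theorem exists_bezout_exponents :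
    ∃ a b c : ℤ, (D.m : ℤ) * a + D.k * b + D.l * c = 1 := by
  obtain ⟨a, b, hab⟩ := D.exists_bezout
  have h := Nat.gcd_eq_gcd_ab D.m D.g
  rw [D.hgcd.gcd_eq_one] at h
  refine ⟨Nat.gcdA D.m D.g, Nat.gcdB D.m D.g * b, Nat.gcdB D.m D.g * a, ?_⟩
  rw [D.hk, D.hl]
  push_cast at h ⊢
  linear_combination (-1 : ℤ) * h + (D.g : ℤ) * Nat.gcdB D.m D.g * hab

/-- The map `(a, b) ↦ (α e^{ia}, α e^{ib}, z)`, where `z ^ m = t + x ^ k * y ^ l` is solved by the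
root of `x ^ k * y ^ l` of argument `(k a + l b) / m` and a correction near `1`. -/
noncomputable def torusParam (v : ℝ × ℝ) : ℂ × ℂ × ℂ :=
  (D.α * Circle.exp v.1, D.α * Circle.exp v.2,
    ((D.α ^ (D.k + D.l)) ^ ((D.m : ℝ)⁻¹) : ℝ) * Circle.exp ((D.k * v.1 + D.l * v.2) / D.m) *
      (1 + D.t / (D.α ^ (D.k + D.l) * Circle.exp (D.k * v.1 + D.l * v.2))) ^ ((D.m : ℂ)⁻¹))

theorem norm_div_lt_one (u : Circle) : ‖D.t / (D.α ^ (D.k + D.l) * u)‖ < 1 := by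
  have h : 0 < D.α ^ (D.k + D.l) := pow_pos D.hα _
  rw [norm_div, norm_mul, Circle.norm_coe, norm_pow, Complex.norm_real, Real.norm_of_nonneg D.hα.le,
    mul_one, div_lt_one h]
  exact D.ht

theorem continuous_torusParam : Continuous D.torusParam := by
  have hexp : Continuous fun s : ℝ => (Circle.exp s : ℂ) :=
    continuous_circle_coe.comp Circle.exp.continuous
  have h : Continuous fun v : ℝ × ℝ =>
      1 + D.t / (D.α ^ (D.k + D.l) * (Circle.exp (D.k * v.1 + D.l * v.2) : ℂ)) := by
    refine continuous_const.add (continuous_const.div ?_ fun v => ?_)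
    · exact continuous_const.mul (hexp.comp (by fun_prop))
    · exact mul_ne_zero (pow_ne_zero _ (by exact_mod_cast D.hα.ne')) (Circle.coe_ne_zero _)
  have h2 := h.cpow (continuous_const (y := (D.m : ℂ)⁻¹)) fun v =>
    one_add_mem_slitPlane (D.norm_div_lt_one _)
  have e1 : Continuous fun v : ℝ × ℝ => (Circle.exp v.1 : ℂ) := hexp.comp continuous_fst
  have e2 : Continuous fun v : ℝ × ℝ => (Circle.exp v.2 : ℂ) := hexp.comp continuous_snd
  have e3 : Continuous fun v : ℝ × ℝ => (Circle.exp ((D.k * v.1 + D.l * v.2) / D.m) : ℂ) :=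
    hexp.comp (by fun_prop)
  unfold torusParam
  exact (continuous_const.mul e1).prodMk ((continuous_const.mul e2).prodMk
    ((continuous_const.mul e3).mul h2))

/-- The corner torus is connected because `gcd (m, k, l) = 1`: the arguments `a`, `b`, `c` of `x`,
`y` and of the root of `x ^ k * y ^ l` can be chosen with `m c = k a + l b` exactly. -/
theorem range_torusParam : Set.range D.torusParam = D.cornerTorus := by
  have hR : 0 < D.α ^ (D.k + D.l) := pow_pos D.hα _
  have hm0 : (D.m : ℝ) ≠ 0 := by exact_mod_cast D.m_ne_zero
  have hα0 : (D.α : ℂ) ≠ 0 := by exact_mod_cast D.hα.ne'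
  have hprod : ∀ a b : ℝ, ((D.α : ℂ) * Circle.exp a) ^ D.k * ((D.α : ℂ) * Circle.exp b) ^ D.l =
      D.α ^ (D.k + D.l) * Circle.exp (D.k * a + D.l * b) := fun a b => by
    rw [Circle.exp_add, Circle.exp_natCast_mul, Circle.exp_natCast_mul]
    push_cast
    ring
  have hr : (((D.α ^ (D.k + D.l)) ^ ((D.m : ℝ)⁻¹) : ℝ) : ℂ) ^ D.m = D.α ^ (D.k + D.l) := by
    rw [← Complex.ofReal_pow, Real.rpow_inv_natCast_pow hR.le D.m_ne_zero]
    push_cast; rfl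
  have hnorm : ∀ a : ℝ, ‖(D.α : ℂ) * Circle.exp a‖ = D.α := fun a => by
    rw [norm_mul, Circle.norm_coe, mul_one, Complex.norm_real, Real.norm_of_nonneg D.hα.le]
  apply Set.Subset.antisymm
  · rintro _ ⟨⟨a, b⟩, rfl⟩
    refine ⟨⟨?_, ?_⟩, hnorm a, hnorm b⟩
    · simp only [torusParam]
      rw [hprod, mul_pow, mul_pow, hr, Complex.cpow_nat_inv_pow _ D.m_ne_zero, ← Circle.coe_pow,
        ← Circle.exp_natCast_mul, mul_div_cancel₀ _ hm0]
      have : (D.α : ℂ) ^ (D.k + D.l) * Circle.exp (D.k * a + D.l * b) ≠ 0 :=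
        mul_ne_zero (pow_ne_zero _ hα0) (Circle.coe_ne_zero _)
      field_simp
      ring
    · simp only [torusParam, hnorm, max_self]
  · rintro ⟨x, y, z⟩ ⟨⟨hz, -⟩, hx, hy⟩
    simp only at hz hx hy
    have hpol : ∀ w : ℂ, ‖w‖ = D.α → ∃ a : ℝ, w = D.α * Circle.exp a := fun w hw => by
      refine ⟨w.arg, ?_⟩
      rw [← hw]; exact (Complex.norm_mul_exp_arg_mul_I w).symm
    obtain ⟨a₀, rfl⟩ := hpol x hx
    obtain ⟨b₀, rfl⟩ := hpol y hy
    rw [hprod] at hz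
    set s : ℂ := D.α ^ (D.k + D.l) * Circle.exp (D.k * a₀ + D.l * b₀) with hs
    have hs0 : s ≠ 0 := mul_ne_zero (pow_ne_zero _ hα0) (Circle.coe_ne_zero _)
    have hsl : 1 + D.t / s ∈ Complex.slitPlane := one_add_mem_slitPlane (D.norm_div_lt_one _)
    set ρ : ℂ := (1 + D.t / s) ^ ((D.m : ℂ)⁻¹) with hρ
    have hρm : ρ ^ D.m = 1 + D.t / s := Complex.cpow_nat_inv_pow _ D.m_ne_zero
    have hρ0 : ρ ≠ 0 := by
      intro h
      rw [h, zero_pow D.m_ne_zero] at hρm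
      exact Complex.slitPlane_ne_zero hsl hρm.symm
    have hc : (z / ρ) ^ D.m = s := by
      rw [div_pow, hz, hρm, div_eq_iff (Complex.slitPlane_ne_zero hsl)]
      field_simp
      ring
    have hcn : ‖z / ρ‖ = (D.α ^ (D.k + D.l)) ^ ((D.m : ℝ)⁻¹) := by
      have h1 : ‖z / ρ‖ ^ D.m = D.α ^ (D.k + D.l) := by
        rw [← norm_pow, hc, hs, norm_mul, Circle.norm_coe, mul_one, norm_pow, Complex.norm_real,
          Real.norm_of_nonneg D.hα.le]
      rw [← h1, Real.pow_rpow_inv_natCast (norm_nonneg _) D.m_ne_zero]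
    set c := (z / ρ).arg
    have hzc : z / ρ = ((D.α ^ (D.k + D.l)) ^ ((D.m : ℝ)⁻¹) : ℝ) * Circle.exp c := by
      rw [← hcn]; exact (Complex.norm_mul_exp_arg_mul_I _).symm
    have hexp : Circle.exp (D.m * c) = Circle.exp (D.k * a₀ + D.l * b₀) := by
      apply Circle.ext
      rw [hzc, mul_pow, hr, ← Circle.coe_pow, ← Circle.exp_natCast_mul] at hc
      exact mul_left_cancel₀ (pow_ne_zero _ hα0) hc
    obtain ⟨N, hN⟩ := Circle.exp_eq_exp.1 hexp
    obtain ⟨n₁, n₂, n₃, hn⟩ := D.exists_bezout_exponents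
    have hn' : (D.m : ℝ) * n₁ + D.k * n₂ + D.l * n₃ = 1 := by exact_mod_cast hn
    have hshift : ∀ (a : ℝ) (n : ℤ), Circle.exp (a + n * (2 * Real.pi)) = Circle.exp a :=
      fun a n => Circle.exp_eq_exp.2 ⟨n, rfl⟩
    have harg : (D.k * (a₀ + ((N * n₂ : ℤ) : ℝ) * (2 * Real.pi)) +
        D.l * (b₀ + ((N * n₃ : ℤ) : ℝ) * (2 * Real.pi))) / D.m =
        c + ((-(N * n₁) : ℤ) : ℝ) * (2 * Real.pi) := by
      rw [div_eq_iff hm0]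
      push_cast
      linear_combination -hN + (N * (2 * Real.pi)) * hn'
    have hsum : Circle.exp (D.k * (a₀ + ((N * n₂ : ℤ) : ℝ) * (2 * Real.pi)) +
        D.l * (b₀ + ((N * n₃ : ℤ) : ℝ) * (2 * Real.pi))) =
        Circle.exp (D.k * a₀ + D.l * b₀) := by
      rw [← hexp]
      refine Circle.exp_eq_exp.2 ⟨-(N * n₁) * D.m, ?_⟩
      rw [div_eq_iff hm0] at harg
      rw [harg]
      push_cast
      ring
    refine ⟨(a₀ + ((N * n₂ : ℤ) : ℝ) * (2 * Real.pi), b₀ + ((N * n₃ : ℤ) : ℝ) * (2 * Real.pi)), ?_⟩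
    simp only [torusParam, harg, hsum, hshift]
    rw [← hs, ← hρ, ← hzc, div_mul_cancel₀ _ hρ0]

theorem isPreconnected_cornerTorus : IsPreconnected D.cornerTorus := by
  rw [← D.range_torusParam]
  exact isPreconnected_range D.continuous_torusParam

/-- Away from the values `x ^ k * y ^ l ∈ (-∞, -1] t`, the function `z` of `y` extends
continuously over a region which is star-shaped about `y = 0` and reaches the corner. -/
theorem exists_preconnected_of_slitPlane {P : ℂ × ℂ × ℂ} (hP : P ∈ D.link) (hx : ‖P.1‖ = D.α)
    (hs : 1 + P.1 ^ D.k * P.2.1 ^ D.l / D.t ∈ Complex.slitPlane) :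
    ∃ A ⊆ D.link, IsPreconnected A ∧ P ∈ A ∧ (A ∩ D.cornerTorus).Nonempty := by
  obtain ⟨x, y, z⟩ := P
  simp only at hx hs
  have hz : z ^ D.m = D.t + x ^ D.k * y ^ D.l := hP.1
  have ht0 := D.ht0
  have hx0 : x ≠ 0 := by rw [← norm_ne_zero_iff, hx]; exact D.hα.ne'
  set ρ : ℂ := (1 + x ^ D.k * y ^ D.l / D.t) ^ ((D.m : ℂ)⁻¹) with hρ
  have hρm : ρ ^ D.m = 1 + x ^ D.k * y ^ D.l / D.t := Complex.cpow_nat_inv_pow _ D.m_ne_zero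
  have hρ0 : ρ ≠ 0 := by
    intro h
    rw [h, zero_pow D.m_ne_zero] at hρm
    exact Complex.slitPlane_ne_zero hs hρm.symm
  have hc : (z / ρ) ^ D.m = D.t := by
    rw [div_pow, hz, hρm, div_eq_iff (Complex.slitPlane_ne_zero hs)]
    field_simp
  let S : Set ℂ := {y | ‖y‖ ≤ D.α ∧ 1 + x ^ D.k * y ^ D.l / D.t ∈ Complex.slitPlane}
  let F : ℂ → ℂ × ℂ × ℂ := fun y => (x, y, z / ρ * (1 + x ^ D.k * y ^ D.l / D.t) ^ ((D.m : ℂ)⁻¹))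
  have hS : StarConvex ℝ 0 S := by
    rw [starConvex_zero_iff]
    rintro y ⟨hy1, hy2⟩ a ha0 ha1
    refine ⟨?_, ?_⟩
    · rw [norm_smul, Real.norm_of_nonneg ha0]
      exact (mul_le_of_le_one_left (norm_nonneg _) ha1).trans hy1
    · have h1 := (starConvex_iff_forall_pos (by simp : (1:ℂ) ∈ Complex.slitPlane)).1
        Complex.starConvex_one_slitPlane hy2
      rcases eq_or_lt_of_le (pow_nonneg ha0 D.l) with h0 | h0
      · rw [Complex.real_smul, mul_pow, ← Complex.ofReal_pow, ← h0]
        simp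
      rcases eq_or_lt_of_le (pow_le_one₀ ha0 ha1 : a ^ D.l ≤ 1) with h2 | h2
      · rw [Complex.real_smul, mul_pow, ← Complex.ofReal_pow, h2]
        simpa using hy2
      convert! h1 (sub_pos.2 h2) h0 (by ring) using 1
      simp only [Complex.real_smul]
      push_cast
      ring
  have hF : ContinuousOn F S := by
    have h1 : ContinuousOn (fun y : ℂ => (1 + x ^ D.k * y ^ D.l / D.t) ^ ((D.m : ℂ)⁻¹)) S :=
      ContinuousOn.cpow (by fun_prop) continuousOn_const fun y hy => hy.2
    exact continuousOn_const.prodMk (continuousOn_id.prodMk (continuousOn_const.mul h1))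
  have hFl : ∀ y ∈ S, F y ∈ D.link := by
    rintro y ⟨hy1, -⟩
    refine ⟨?_, ?_⟩
    · simp only [F]
      rw [mul_pow, hc, Complex.cpow_nat_inv_pow _ D.m_ne_zero]
      field_simp
    · simp only [F, hx]; exact max_eq_left hy1
  refine ⟨F '' S, ?_, (hS.isPathConnected ?_).isConnected.isPreconnected.image F hF,
    ⟨y, ⟨D.norm_snd_le hP, hs⟩, ?_⟩, ?_⟩
  · rintro _ ⟨y, hy, rfl⟩; exact hFl y hy
  · exact ⟨by simpa using D.hα.le, by simp [D.l_ne_zero]⟩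
  · simp only [F, ← hρ]
    rw [div_mul_cancel₀ _ hρ0]
  · obtain ⟨y₁, hy₁⟩ := IsAlgClosed.exists_pow_nat_eq
      (D.t / x ^ D.k * ((D.α ^ (D.k + D.l) / ‖D.t‖ : ℝ) : ℂ)) (Nat.pos_of_ne_zero D.l_ne_zero)
    have ht0' : ‖D.t‖ ≠ 0 := norm_ne_zero_iff.2 D.ht0
    have hpos : 0 < D.α ^ (D.k + D.l) / ‖D.t‖ :=
      div_pos (pow_pos D.hα _) (norm_pos_iff.2 D.ht0)
    have hn : ‖y₁‖ = D.α := by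
      refine (pow_left_inj₀ (norm_nonneg _) D.hα.le D.l_ne_zero).1 ?_
      rw [← norm_pow, hy₁, norm_mul, norm_div, norm_pow, hx, Complex.norm_real,
        Real.norm_of_nonneg hpos.le, pow_add]
      have := D.hα.ne'
      field_simp
    have hmem : y₁ ∈ S := by
      refine ⟨hn.le, ?_⟩
      rw [hy₁]
      have : 1 + x ^ D.k * (D.t / x ^ D.k * ((D.α ^ (D.k + D.l) / ‖D.t‖ : ℝ) : ℂ)) / D.t =
          ((1 + D.α ^ (D.k + D.l) / ‖D.t‖ : ℝ) : ℂ) := by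
        rw [Complex.ofReal_add, Complex.ofReal_one]
        field_simp
      rw [this, Complex.ofReal_mem_slitPlane]
      linarith
    exact ⟨F y₁, ⟨y₁, hmem, rfl⟩, hFl _ hmem, hx, hn⟩

/-- For `x ^ k * y ^ l = -(1 + b) t` with `b ≥ 0`, moving `y` radially outwards keeps `z ^ m` on
the ray through `-t`, along which a continuous root is real up to a constant. -/
theorem exists_preconnected_of_nonpos {P : ℂ × ℂ × ℂ} (hP : P ∈ D.link) (hx : ‖P.1‖ = D.α)
    {b : ℝ} (hb : 0 ≤ b) (hs : P.1 ^ D.k * P.2.1 ^ D.l = -(1 + b) * D.t) :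
    ∃ A ⊆ D.link, IsPreconnected A ∧ P ∈ A ∧ (A ∩ D.cornerTorus).Nonempty := by
  obtain ⟨x, y, z⟩ := P
  simp only at hx hs
  have hz : z ^ D.m = D.t + x ^ D.k * y ^ D.l := hP.1
  have hy0 : y ≠ 0 := by
    rintro rfl
    rw [zero_pow D.l_ne_zero, mul_zero] at hs
    have h1 : (-(1 + b) : ℂ) ≠ 0 := by
      have : (-(1 + b) : ℝ) ≠ 0 := by linarith
      exact_mod_cast this
    exact mul_ne_zero h1 D.ht0 hs.symm
  have hyn : 0 < ‖y‖ := norm_pos_iff.2 hy0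
  have hroot : ∃ z₁ : ℂ, z₁ ^ D.m = -D.t ∧ z = z₁ * ((b ^ ((D.m : ℝ)⁻¹) : ℝ) : ℂ) := by
    have hpow : ((b ^ ((D.m : ℝ)⁻¹) : ℝ) : ℂ) ^ D.m = b := by
      rw [← Complex.ofReal_pow, Real.rpow_inv_natCast_pow hb D.m_ne_zero]
    have hzb : z ^ D.m = -D.t * b := by rw [hz, hs]; ring
    rcases eq_or_lt_of_le hb with h0 | h0
    · obtain ⟨z₁, hz₁⟩ := IsAlgClosed.exists_pow_nat_eq (-D.t) (Nat.pos_of_ne_zero D.m_ne_zero)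
      refine ⟨z₁, hz₁, ?_⟩
      rw [← h0, Complex.ofReal_zero, mul_zero] at hzb
      have hz0 : z = 0 := by simpa [D.m_ne_zero] using hzb
      rw [hz0, ← h0, Real.zero_rpow (by simpa using D.m_ne_zero)]
      simp
    · have hb0 : (b : ℂ) ≠ 0 := by exact_mod_cast h0.ne'
      have h1 : ((b ^ ((D.m : ℝ)⁻¹) : ℝ) : ℂ) ≠ 0 := by
        exact_mod_cast (Real.rpow_pos_of_pos h0 _).ne'
      exact ⟨z / ((b ^ ((D.m : ℝ)⁻¹) : ℝ) : ℂ), by rw [div_pow, hpow, hzb, mul_div_cancel_right₀ _ hb0],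
        by rw [div_mul_cancel₀ _ h1]⟩
  obtain ⟨z₁, hz₁, hzz⟩ := hroot
  let F : ℝ → ℂ × ℂ × ℂ := fun r =>
    (x, r * y, z₁ * (((r ^ D.l * (1 + b) - 1) ^ ((D.m : ℝ)⁻¹) : ℝ) : ℂ))
  have hF : Continuous F := by
    have h1 : Continuous fun r : ℝ => (r ^ D.l * (1 + b) - 1) ^ ((D.m : ℝ)⁻¹) :=
      Continuous.rpow_const (by fun_prop) fun r => Or.inr (by positivity)
    have h2 : Continuous fun r : ℝ => (((r ^ D.l * (1 + b) - 1) ^ ((D.m : ℝ)⁻¹) : ℝ) : ℂ) :=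
      Complex.continuous_ofReal.comp h1
    fun_prop
  have hFn : ∀ r : ℝ, 0 ≤ r → ‖(F r).2.1‖ = r * ‖y‖ := fun r hr => by
    simp only [F, norm_mul, Complex.norm_real, Real.norm_of_nonneg hr]
  have hFl : ∀ r ∈ Set.Icc 1 (D.α / ‖y‖), F r ∈ D.link := by
    rintro r ⟨hr1, hr2⟩
    refine ⟨?_, ?_⟩
    · have h1 : 0 ≤ r ^ D.l * (1 + b) - 1 := by
        nlinarith [one_le_pow₀ hr1 (n := D.l)]
      simp only [F]
      rw [mul_pow, hz₁, ← Complex.ofReal_pow, Real.rpow_inv_natCast_pow h1 D.m_ne_zero]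
      push_cast
      linear_combination -(r : ℂ) ^ D.l * hs
    · rw [hFn r (by linarith)]
      simp only [F, hx]
      exact max_eq_left ((le_div_iff₀ hyn).1 hr2)
  have h1α : 1 ≤ D.α / ‖y‖ := (one_le_div hyn).2 (D.norm_snd_le hP)
  refine ⟨F '' Set.Icc 1 (D.α / ‖y‖), ?_, isPreconnected_Icc.image F hF.continuousOn,
    ⟨1, ⟨le_rfl, h1α⟩, ?_⟩, F (D.α / ‖y‖), ⟨_, ⟨h1α, le_rfl⟩, rfl⟩, hFl _ ⟨h1α, le_rfl⟩, hx, ?_⟩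
  · rintro _ ⟨r, hr, rfl⟩; exact hFl r hr
  · simp only [F]
    rw [one_pow, one_mul, add_sub_cancel_left, ← hzz, Complex.ofReal_one, one_mul]
  · rw [hFn _ (by linarith), div_mul_cancel₀ _ hyn.ne']

theorem exists_preconnected_of_norm_fst {P : ℂ × ℂ × ℂ} (hP : P ∈ D.link) (hx : ‖P.1‖ = D.α) :
    ∃ A ⊆ D.link, IsPreconnected A ∧ P ∈ A ∧ (A ∩ D.cornerTorus).Nonempty := by
  by_cases hs : 1 + P.1 ^ D.k * P.2.1 ^ D.l / D.t ∈ Complex.slitPlane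
  · exact D.exists_preconnected_of_slitPlane hP hx hs
  · rw [Complex.mem_slitPlane_iff, not_or, not_lt, not_not] at hs
    set w := 1 + P.1 ^ D.k * P.2.1 ^ D.l / D.t with hw
    refine D.exists_preconnected_of_nonpos hP hx (b := -w.re) (by linarith [hs.1]) ?_
    have h1 : (w.re : ℂ) = w := Complex.ext (by simp) (by simp [hs.2])
    push_cast
    rw [h1, hw]
    have := D.ht0
    field_simp
    ring

theorem exists_preconnected {P : ℂ × ℂ × ℂ} (hP : P ∈ D.link) :
    ∃ A ⊆ D.link, IsPreconnected A ∧ P ∈ A ∧ (A ∩ D.cornerTorus).Nonempty := by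
  rcases D.norm_eq_or hP with hx | hy
  · exact D.exists_preconnected_of_norm_fst hP hx
  · obtain ⟨A, hA, hc, hPA, Q, hQA, hQ, hQ1, hQ2⟩ :=
      D.swap.exists_preconnected_of_norm_fst (D.flip_mem hP) hy
    refine ⟨flip '' A, ?_, hc.image _ continuous_flip.continuousOn, ⟨_, hPA, rfl⟩, flip Q,
      ⟨Q, hQA, rfl⟩, D.swap.flip_mem hQ, hQ2, hQ1⟩
    rintro _ ⟨R, hR, rfl⟩
    exact D.swap.flip_mem (hA hR)

theorem isConnected_link : IsConnected D.link := by
  have h0 : D.torusParam 0 ∈ D.cornerTorus := D.range_torusParam ▸ Set.mem_range_self _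
  refine ⟨⟨_, h0.1⟩, isPreconnected_of_forall (D.torusParam 0) fun P hP => ?_⟩
  obtain ⟨A, hA, hc, hPA, Q, hQA, hQT⟩ := D.exists_preconnected hP
  exact ⟨D.cornerTorus ∪ A, Set.union_subset (fun R hR => hR.1) hA, Or.inl h0, Or.inr hPA,
    D.isPreconnected_cornerTorus.union Q hQT hQA hc⟩

/-! ### Compactness of the link -/

theorem isClosed_link : IsClosed D.link :=
  (isClosed_eq (by fun_prop) (by fun_prop)).inter (isClosed_eq (by fun_prop) (by fun_prop))

theorem isCompact_link : IsCompact D.link := by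
  refine Metric.isCompact_of_isClosed_isBounded D.isClosed_link ?_
  rw [isBounded_iff_forall_norm_le]
  refine ⟨max D.α (max D.α (max 1 (‖D.t‖ + D.α ^ (D.k + D.l)))), fun P hP => ?_⟩
  have hz : ‖P.2.2‖ ≤ max 1 (‖D.t‖ + D.α ^ (D.k + D.l)) := by
    rw [le_max_iff, or_iff_not_imp_left, not_le]
    intro h
    calc ‖P.2.2‖ ≤ ‖P.2.2‖ ^ D.m := le_self_pow₀ h.le D.m_ne_zero
      _ = ‖D.t + P.1 ^ D.k * P.2.1 ^ D.l‖ := by rw [← norm_pow, hP.1]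
      _ ≤ _ := (norm_add_le _ _).trans (by gcongr; exact D.norm_pow_mul_le hP)
  rw [Prod.norm_def, Prod.norm_def]
  exact max_le_max (D.norm_fst_le hP) (max_le_max (D.norm_snd_le hP) hz)

/-! ### Adapted tubes -/

/-- The exchange of `x` and `y` as a linear map. -/
noncomputable def flipL : ℂ × ℂ × ℂ →L[ℝ] ℂ × ℂ × ℂ :=
  ((ContinuousLinearMap.fst ℝ ℂ ℂ).comp (ContinuousLinearMap.snd ℝ ℂ (ℂ × ℂ))).prod
    ((ContinuousLinearMap.fst ℝ ℂ (ℂ × ℂ)).prod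
      ((ContinuousLinearMap.snd ℝ ℂ ℂ).comp (ContinuousLinearMap.snd ℝ ℂ (ℂ × ℂ))))

theorem flipL_apply (P : ℂ × ℂ × ℂ) : flipL P = flip P := rfl

/-- Linear coordinates `ℂ³ → ℂ × ℝ` which restrict to oriented local coordinates at `P` of the side
`|x| = α`, `|y| < α` of the link: a complex coordinate of the curve `x = const`, followed by
the infinitesimal change of `arg x`. The complex coordinate is `y` where `z ≠ 0`, and
`z` where `z = 0` (and so `y ≠ 0`). The orientation is that of the boundary of the Milnor fibre. -/
noncomputable def sideFrame (P : ℂ × ℂ × ℂ) : ℂ × ℂ × ℂ →L[ℝ] ℂ × ℝ :=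
  ((if P.2.2 = 0 then ContinuousLinearMap.snd ℝ ℂ ℂ else ContinuousLinearMap.fst ℝ ℂ ℂ).comp
    (ContinuousLinearMap.snd ℝ ℂ (ℂ × ℂ))).prod
  (Complex.imCLM.comp ((ContinuousLinearMap.mul ℝ ℂ (starRingEnd ℂ P.1)).comp
    (ContinuousLinearMap.fst ℝ ℂ (ℂ × ℂ))))

theorem sideFrame_apply (P R : ℂ × ℂ × ℂ) : sideFrame P R =
    (if P.2.2 = 0 then R.2.2 else R.2.1, (starRingEnd ℂ P.1 * R.1).im) := by
  unfold sideFrame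
  split_ifs <;> rfl

/-- Linear coordinates inducing oriented local coordinates at a point `P` off the corner. -/
noncomputable def frame (P : ℂ × ℂ × ℂ) : ℂ × ℂ × ℂ →L[ℝ] ℂ × ℝ :=
  open Classical in
  if ‖P.2.1‖ < D.α then sideFrame P else (sideFrame (flip P)).comp flipL

/-- The chart at a corner point `P` which defines the smooth structure there: its components are
`log |y / x|`, and the sines of the changes of `arg y` and (up to a factor) of `arg x`. -/
noncomputable def cornerChart (P R : ℂ × ℂ × ℂ) : ℂ × ℝ :=
  (((Real.log ‖R.2.1‖ - Real.log ‖R.1‖ : ℝ) : ℂ) +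
    ((D.α * (R.2.1 / ‖R.2.1‖ / P.2.1)).im : ℂ) * Complex.I, (R.1 / ‖R.1‖ / P.1).im)

/-- A tube is adapted if it is a smooth oriented parametrization off the corner and if, at
the corner, it is one when read in the corner chart. -/
structure IsAdapted (φ : OpenPartialHomeomorph (ℂ × Circle) D.link) : Prop where
  contDiffAt : ∀ Q, torusLift Q ∈ φ.source →
    ¬ (‖(φ (torusLift Q)).1.1‖ = D.α ∧ ‖(φ (torusLift Q)).1.2.1‖ = D.α) →
      ContDiffAt ℝ ∞ (fun R => (φ (torusLift R) : ℂ × ℂ × ℂ)) Q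
  det_pos : ∀ Q, torusLift Q ∈ φ.source →
    ¬ (‖(φ (torusLift Q)).1.1‖ = D.α ∧ ‖(φ (torusLift Q)).1.2.1‖ = D.α) →
      0 < ((D.frame (φ (torusLift Q))).comp
        (fderiv ℝ (fun R => (φ (torusLift R) : ℂ × ℂ × ℂ)) Q)).det
  corner : ∀ Q, torusLift Q ∈ φ.source →
    ‖(φ (torusLift Q)).1.1‖ = D.α ∧ ‖(φ (torusLift Q)).1.2.1‖ = D.α →
      ContDiffAt ℝ ∞ (fun R => D.cornerChart (φ (torusLift Q)) (φ (torusLift R))) Q ∧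
      0 < (fderiv ℝ (fun R => D.cornerChart (φ (torusLift Q)) (φ (torusLift R))) Q).det

theorem infty_ne_zero : (∞ : WithTop ℕ∞) ≠ 0 := by simp

theorem IsAdapted.injective_fderiv {φ : OpenPartialHomeomorph (ℂ × Circle) D.link}
    (h : D.IsAdapted φ) {Q : ℂ × ℝ} (hQ : torusLift Q ∈ φ.source)
    (hc : ¬ (‖(φ (torusLift Q)).1.1‖ = D.α ∧ ‖(φ (torusLift Q)).1.2.1‖ = D.α)) :
    Function.Injective (fderiv ℝ (fun R => (φ (torusLift R) : ℂ × ℂ × ℂ)) Q) := by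
  have hd := (h.det_pos Q hQ hc).ne'
  set L := fderiv ℝ (fun R => (φ (torusLift R) : ℂ × ℂ × ℂ)) Q
  let e := ContinuousLinearMap.toContinuousLinearEquivOfDetNeZero _ hd
  have he : Function.Injective ((D.frame (φ (torusLift Q))).comp L) := e.injective
  exact Function.Injective.of_comp he

/-- Adapted tubes change coordinates smoothly and orientedly, because the local coordinate used
at a point of the link does not depend on the tube. -/
theorem IsAdapted.compatible {φ ψ : OpenPartialHomeomorph (ℂ × Circle) D.link}
    (hφ : D.IsAdapted φ) (hψ : D.IsAdapted ψ) : OrientedSmoothCompatible φ ψ := by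
  intro P P' hP hP' h
  by_cases hc : ‖(φ (torusLift P)).1.1‖ = D.α ∧ ‖(φ (torusLift P)).1.2.1‖ = D.α
  · have h1 := hφ.corner P hP hc
    have h2 := hψ.corner P' hP' (h ▸ hc)
    rw [← h] at h2
    exact exists_transition hP hP' h (fun R => D.cornerChart (φ (torusLift P)) R)
      h1.1 h1.2 h2.1 h2.2
  · have key : ∀ (χ : OpenPartialHomeomorph (ℂ × Circle) D.link) (R : ℂ × ℝ), D.IsAdapted χ →
        torusLift R ∈ χ.source → χ (torusLift R) = φ (torusLift P) →
        ContDiffAt ℝ ∞ (fun Q => D.frame (φ (torusLift P)) (χ (torusLift Q))) R ∧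
        0 < (fderiv ℝ (fun Q => D.frame (φ (torusLift P)) (χ (torusLift Q))) R).det := by
      intro χ R hχ hR hRP
      rw [← hRP] at hc ⊢
      have h1 := hχ.contDiffAt R hR hc
      have h2 := hχ.det_pos R hR hc
      have hL := (D.frame (χ (torusLift R))).hasFDerivAt
        (x := (χ (torusLift R) : ℂ × ℂ × ℂ))
      refine ⟨(D.frame (χ (torusLift R))).contDiff.contDiffAt.comp R h1, ?_⟩
      have h3 := hL.comp R (h1.differentiableAt infty_ne_zero).hasFDerivAt
      rw [show (fun Q => D.frame (χ (torusLift R)) (χ (torusLift Q))) =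
        (D.frame (χ (torusLift R))) ∘ (fun Q => (χ (torusLift Q) : ℂ × ℂ × ℂ)) from rfl, h3.fderiv]
      exact h2
    obtain ⟨h1, h2⟩ := key φ P hφ hP rfl
    obtain ⟨h3, h4⟩ := key ψ P' hψ hP' h.symm
    exact exists_transition hP hP' h (fun R => D.frame (φ (torusLift P)) R) h1 h2 h3 h4

/-- A tube in the side `|y| < α` of the link which is a smooth oriented parametrization. -/
def IsSideAdapted (φ : OpenPartialHomeomorph (ℂ × Circle) D.link) : Prop :=
  ∀ Q, torusLift Q ∈ φ.source → ‖(φ (torusLift Q)).1.2.1‖ < D.α ∧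
    ContDiffAt ℝ ∞ (fun R => (φ (torusLift R) : ℂ × ℂ × ℂ)) Q ∧
    0 < ((sideFrame (φ (torusLift Q))).comp
        (fderiv ℝ (fun R => (φ (torusLift R) : ℂ × ℂ × ℂ)) Q)).det

variable {D}

theorem IsSideAdapted.isAdapted {φ : OpenPartialHomeomorph (ℂ × Circle) D.link}
    (h : D.IsSideAdapted φ) : D.IsAdapted φ where
  contDiffAt Q hQ _ := (h Q hQ).2.1
  det_pos Q hQ _ := by
    obtain ⟨h1, -, h3⟩ := h Q hQ
    rw [frame, if_pos h1]
    exact h3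
  corner Q hQ hc := absurd hc.2 (h Q hQ).1.ne

theorem IsSideAdapted.isAdapted_flip {φ : OpenPartialHomeomorph (ℂ × Circle) D.swap.link}
    (h : D.swap.IsSideAdapted φ) : D.IsAdapted (φ.transHomeomorph D.flipHomeo) where
  contDiffAt Q hQ _ := flipL.contDiff.contDiffAt.comp Q (h Q hQ).2.1
  det_pos Q hQ _ := by
    obtain ⟨h1, h2, h3⟩ := h Q hQ
    have hn : ¬ ‖(φ.transHomeomorph D.flipHomeo (torusLift Q)).1.2.1‖ < D.α := by
      have := D.swap.norm_fst_of_lt (φ (torusLift Q)).2 h1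
      exact not_lt.2 this.ge
    rw [frame, if_neg hn]
    have h4 : fderiv ℝ (fun R => (φ.transHomeomorph D.flipHomeo (torusLift R) : ℂ × ℂ × ℂ)) Q =
        flipL.comp (fderiv ℝ (fun R => (φ (torusLift R) : ℂ × ℂ × ℂ)) Q) :=
      (flipL.hasFDerivAt.comp Q (h2.differentiableAt infty_ne_zero).hasFDerivAt).fderiv
    rw [h4]
    exact h3
  corner Q hQ hc := absurd hc.1 (h Q hQ).1.ne

theorem isFibredSolidTorus_flip {φ : OpenPartialHomeomorph (ℂ × Circle) D.swap.link}
    (h : IsFibredSolidTorus (Set.range D.swap.orbit) φ) :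
    IsFibredSolidTorus (Set.range D.orbit) (φ.transHomeomorph D.flipHomeo) := by
  obtain ⟨h1, p, q, hp, hpq, h2⟩ := h
  refine ⟨h1, p, q, hp, hpq, fun P hP => ?_⟩
  obtain ⟨R, hR⟩ := h2 P hP
  refine ⟨D.flipHomeo R, ?_⟩
  have : φ.transHomeomorph D.flipHomeo '' modelLeaf p q P =
      D.flipHomeo '' (φ '' modelLeaf p q P) := by
    rw [← Set.image_comp]; rfl
  rw [this, ← hR]
  -- exchanging `x` and `y` inverts the circle action
  ext Q
  constructor
  · rintro ⟨u, hu⟩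
    refine ⟨D.flipHomeo.symm Q, ⟨u⁻¹, ?_⟩, by simp⟩
    change flip Q.1 = _
    rw [hu]
    simp only [spin, flip, swap, inv_pow, inv_inv]
    rfl
  · rintro ⟨S, ⟨u, hu⟩, rfl⟩
    refine ⟨u⁻¹, ?_⟩
    change flip S.1 = _
    rw [hu]
    simp only [spin, flip, swap, inv_pow, inv_inv]
    rfl

/-! ### Construction of tubes -/

/-- The open solid torus. -/
abbrev solidTorus : Set (ℂ × Circle) := Metric.ball (0 : ℂ) 1 ×ˢ Set.univ

theorem mem_solidTorus {Q : ℂ × Circle} : Q ∈ solidTorus ↔ ‖Q.1‖ < 1 := by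
  simp [solidTorus]

/-- A formula `F` with values in the link and a continuous inverse `G` of it on an open set define a
tube. -/
theorem exists_tube_of_inverse {F : ℂ × Circle → ℂ × ℂ × ℂ} {U : Set D.link}
    {G : D.link → ℂ × Circle} (hU : IsOpen U) (hF : ContinuousOn F solidTorus)
    (hFl : ∀ Q ∈ solidTorus, F Q ∈ D.link) (hFU : ∀ P : D.link, ∀ Q ∈ solidTorus, P.1 = F Q → P ∈ U)
    (hG : ContinuousOn G U) (hGs : ∀ P ∈ U, G P ∈ solidTorus)
    (hGF : ∀ P : D.link, ∀ Q ∈ solidTorus, P.1 = F Q → G P = Q)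
    (hFG : ∀ P ∈ U, F (G P) = P.1) :
    ∃ φ : OpenPartialHomeomorph (ℂ × Circle) D.link, φ.source = solidTorus ∧
      ∀ Q ∈ solidTorus, (φ Q : ℂ × ℂ × ℂ) = F Q := by
  classical
  have hne : (0, 1) ∈ solidTorus := by simp
  let f : ℂ × Circle → D.link := fun Q => if h : F Q ∈ D.link then ⟨F Q, h⟩ else ⟨_, hFl _ hne⟩
  have hf : ∀ Q ∈ solidTorus, (f Q : ℂ × ℂ × ℂ) = F Q := fun Q hQ => by
    simp only [f, dif_pos (hFl Q hQ)]
  refine ⟨{ toFun := f, invFun := G, source := solidTorus, target := U,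
            map_source' := fun Q hQ => hFU _ Q hQ (hf Q hQ), map_target' := hGs,
            left_inv' := fun Q hQ => hGF _ Q hQ (hf Q hQ)
            right_inv' := fun P hP => Subtype.ext ((hf _ (hGs P hP)).trans (hFG P hP))
            open_source := Metric.isOpen_ball.prod isOpen_univ, open_target := hU,
            continuousOn_toFun := ?_, continuousOn_invFun := hG }, rfl, hf⟩
  rw [Topology.IsInducing.subtypeVal.continuousOn_iff]
  exact hF.congr hf

theorem isFibredSolidTorus_of_equivariant {F : ℂ × Circle → ℂ × ℂ × ℂ}
    {φ : OpenPartialHomeomorph (ℂ × Circle) D.link} (hφ : φ.source = solidTorus)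
    (hφF : ∀ Q ∈ solidTorus, (φ Q : ℂ × ℂ × ℂ) = F Q) {p : ℕ} {q : ℤ} (hp : 1 ≤ p)
    (hpq : IsCoprime (p : ℤ) q)
    (hF : ∀ Q ∈ solidTorus, ∀ u : Circle,
      F (((u ^ q : Circle) : ℂ) * Q.1, u ^ p * Q.2) = D.spin u (F Q)) :
    IsFibredSolidTorus (Set.range D.orbit) φ := by
  refine ⟨hφ, p, q, hp, hpq, fun Q hQ => ⟨φ Q, ?_⟩⟩
  rw [hφ] at hQ
  have hφu : ∀ u : Circle, (φ (((u ^ q : Circle) : ℂ) * Q.1, u ^ p * Q.2) : ℂ × ℂ × ℂ) =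
      D.spin u (φ Q) := fun u => by
    rw [hφF Q hQ, ← hF Q hQ u]
    apply hφF
    rw [mem_solidTorus] at hQ ⊢
    simpa only [norm_mul, Circle.norm_coe, one_mul] using hQ
  ext P
  constructor
  · rintro ⟨u, hu⟩
    exact ⟨_, ⟨u, rfl⟩, Subtype.ext ((hφu u).trans hu.symm)⟩
  · rintro ⟨_, ⟨u, rfl⟩, rfl⟩
    exact ⟨u, hφu u⟩

/-- A formula for a tube can be differentiated in place of the tube. -/
theorem eventuallyEq_lift {F : ℂ × Circle → ℂ × ℂ × ℂ}
    {φ : OpenPartialHomeomorph (ℂ × Circle) D.link} (hφ : φ.source = solidTorus)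
    (hφF : ∀ Q ∈ solidTorus, (φ Q : ℂ × ℂ × ℂ) = F Q) {Q : ℂ × ℝ} (hQ : torusLift Q ∈ φ.source) :
    (fun R => (φ (torusLift R) : ℂ × ℂ × ℂ)) =ᶠ[𝓝 Q] fun R => F (torusLift R) := by
  filter_upwards [continuous_torusLift.continuousAt.eventually (φ.open_source.mem_nhds hQ)]
    with R hR
  exact hφF _ (hφ ▸ hR)

/-- The Jacobian criterion for tubes on the side `|y| < α`: the discs `v = const` are mapped
holomorphically into the curves `x = const`, while `x = x₀ e^{i n θ}` turns positively. -/
theorem det_sideFrame_pos {Φ : ℂ × ℝ → ℂ × ℂ × ℂ} {Q : ℂ × ℝ} (hΦ : ContDiffAt ℝ ∞ Φ Q)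
    {x₀ : ℂ} (hx₀ : x₀ ≠ 0) {n : ℕ} (hn : n ≠ 0)
    (hx : ∀ R, (Φ R).1 = x₀ * Complex.exp (n * R.2 * Complex.I)) {a : ℂ} (ha : a ≠ 0)
    (hw : HasDerivAt (fun w => if (Φ Q).2.2 = 0 then (Φ (w, Q.2)).2.2 else (Φ (w, Q.2)).2.1) a Q.1) :
    0 < ((sideFrame (Φ Q)).comp (fderiv ℝ Φ Q)).det := by
  have hd := (hΦ.differentiableAt infty_ne_zero).hasFDerivAt
  have hL := (sideFrame (Φ Q)).hasFDerivAt (x := Φ Q) |>.comp Q hd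
  have hn' : (0 : ℝ) < n := by positivity
  have hx₀' : 0 < Complex.normSq x₀ := Complex.normSq_pos.2 hx₀
  refine det_pos_of_complex_slice _ ha (mul_pos hx₀' hn') (fun w => ?_) ?_
  · -- restrict to the disc `θ = const`
    have hs : HasFDerivAt (fun w : ℂ => (w, Q.2)) (ContinuousLinearMap.inl ℝ ℂ ℝ) Q.1 :=
      hasFDerivAt_prodMk_left Q.1 Q.2
    have h1 := HasFDerivAt.comp (g := sideFrame (Φ Q) ∘ Φ) Q.1 hL hs
    have h2 : HasFDerivAt ((sideFrame (Φ Q) ∘ Φ) ∘ fun w : ℂ => (w, Q.2))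
        (((ContinuousLinearMap.toSpanSingleton ℂ a).restrictScalars ℝ).prod 0) Q.1 := by
      have h3 := (hw.hasFDerivAt.restrictScalars ℝ).prodMk
        (hasFDerivAt_const (𝕜 := ℝ) (starRingEnd ℂ (Φ Q).1 * (Φ Q).1).im Q.1)
      refine h3.congr_of_eventuallyEq (Filter.Eventually.of_forall fun w => ?_)
      simp only [Function.comp, sideFrame_apply, hx]
    have h3 := congrArg (fun L : ℂ →L[ℝ] ℂ × ℝ => L w) (h1.unique h2)
    simpa [mul_comm] using h3
  · -- restrict to the circle `w = const`
    have hs : HasFDerivAt (fun θ : ℝ => (Q.1, θ)) (ContinuousLinearMap.inr ℝ ℂ ℝ) Q.2 :=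
      hasFDerivAt_prodMk_right Q.1 Q.2
    have h1 := (HasFDerivAt.comp (g := sideFrame (Φ Q) ∘ Φ) Q.2 hL hs).snd.hasDerivAt
    have hfun : (fun θ : ℝ => (((sideFrame (Φ Q) ∘ Φ) ∘ fun θ : ℝ => (Q.1, θ)) θ).2) =
        fun θ : ℝ => Complex.normSq x₀ * Real.sin (n * (θ - Q.2)) := by
      funext θ
      simp only [Function.comp, sideFrame_apply, hx]
      have e1 : starRingEnd ℂ (x₀ * Complex.exp (n * Q.2 * Complex.I)) *
          (x₀ * Complex.exp (n * θ * Complex.I)) =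
          (Complex.normSq x₀ : ℂ) * Complex.exp ((n * (θ - Q.2) : ℝ) * Complex.I) := by
        rw [map_mul, ← Complex.exp_conj, Complex.normSq_eq_conj_mul_self, mul_mul_mul_comm,
          ← Complex.exp_add]
        congr 2
        simp
        ring
      rw [e1, Complex.im_ofReal_mul, Complex.exp_ofReal_mul_I_im]
    have h2 : HasDerivAt (fun θ : ℝ => Complex.normSq x₀ * Real.sin (n * (θ - Q.2)))
        (Complex.normSq x₀ * n) Q.2 := by
      have h3 := (((hasDerivAt_id Q.2).sub_const Q.2).const_mul (n : ℝ)).sin.const_mul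
        (Complex.normSq x₀)
      simpa using h3
    rw [hfun] at h1
    have h3 := h1.unique h2
    simpa using h3

theorem det_sideFrame_pos_of_ne {Φ : ℂ × ℝ → ℂ × ℂ × ℂ} {Q : ℂ × ℝ} (hΦ : ContDiffAt ℝ ∞ Φ Q)
    {x₀ : ℂ} (hx₀ : x₀ ≠ 0) {n : ℕ} (hn : n ≠ 0)
    (hx : ∀ R, (Φ R).1 = x₀ * Complex.exp (n * R.2 * Complex.I)) (hz : (Φ Q).2.2 ≠ 0) {a : ℂ}
    (ha : a ≠ 0) (hw : HasDerivAt (fun w => (Φ (w, Q.2)).2.1) a Q.1) :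
    0 < ((sideFrame (Φ Q)).comp (fderiv ℝ Φ Q)).det :=
  det_sideFrame_pos hΦ hx₀ hn hx ha (by simpa only [if_neg hz] using hw)

/-- A tube given by a formula `Φ` on the side `|y| < α` is adapted if it maps the discs `v = const`
holomorphically into the curves `x = const`, while `x = x₀ e^{i n θ}` turns positively. -/
theorem isSideAdapted_of_formula {F : ℂ × Circle → ℂ × ℂ × ℂ}
    {φ : OpenPartialHomeomorph (ℂ × Circle) D.link} (hφ : φ.source = solidTorus)
    (hφF : ∀ Q ∈ solidTorus, (φ Q : ℂ × ℂ × ℂ) = F Q) (Φ : ℂ × ℝ → ℂ × ℂ × ℂ)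
    (hΦF : ∀ R, F (torusLift R) = Φ R) {x₀ : ℂ} (hx₀ : x₀ ≠ 0) {n : ℕ} (hn : n ≠ 0)
    (hx : ∀ R, (Φ R).1 = x₀ * Complex.exp (n * R.2 * Complex.I))
    (hy : ∀ Q : ℂ × ℝ, ‖Q.1‖ < 1 → ‖(Φ Q).2.1‖ < D.α)
    (hΦ : ∀ Q : ℂ × ℝ, ‖Q.1‖ < 1 → ContDiffAt ℝ ∞ Φ Q)
    (hw₀ : ∀ Q : ℂ × ℝ, ‖Q.1‖ < 1 → (Φ Q).2.2 = 0 →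
      ∃ a ≠ 0, HasDerivAt (fun w => (Φ (w, Q.2)).2.2) a Q.1)
    (hw : ∀ Q : ℂ × ℝ, ‖Q.1‖ < 1 → (Φ Q).2.2 ≠ 0 →
      ∃ a ≠ 0, HasDerivAt (fun w => (Φ (w, Q.2)).2.1) a Q.1) :
    D.IsSideAdapted φ := by
  intro Q hQ
  have he := eventuallyEq_lift hφ hφF hQ
  simp only [hΦF] at he
  have hQ' := hφ ▸ hQ
  have hQ1 : ‖Q.1‖ < 1 := mem_solidTorus.1 hQ'
  rw [he.fderiv_eq (𝕜 := ℝ), hφF _ hQ', hΦF]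
  refine ⟨hy Q hQ1, (hΦ Q hQ1).congr_of_eventuallyEq he, ?_⟩
  by_cases hz : (Φ Q).2.2 = 0
  · obtain ⟨a, ha, hd⟩ := hw₀ Q hQ1 hz
    exact det_sideFrame_pos (hΦ Q hQ1) hx₀ hn hx ha (by simpa only [if_pos hz] using hd)
  · obtain ⟨a, ha, hd⟩ := hw Q hQ1 hz
    exact det_sideFrame_pos_of_ne (hΦ Q hQ1) hx₀ hn hx hz ha hd

/-- Tubes whose leaves are all regular. They are given by a cross-section `(ξ, η, ζ)`, which meets
nearby leaves once, and by a local function `β` on the link which recovers the leaf. -/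
theorem exists_regular_tube {ξ η ζ : ℂ → ℂ} {β : D.link → ℂ} {U : Set D.link} (hU : IsOpen U)
    (hξ : ContinuousOn ξ (Metric.ball 0 1)) (hη : ContinuousOn η (Metric.ball 0 1))
    (hζ : ContinuousOn ζ (Metric.ball 0 1))
    (hξ0 : ∀ w ∈ Metric.ball (0 : ℂ) 1, ξ w ≠ 0) (hη0 : ∀ w ∈ Metric.ball (0 : ℂ) 1, η w ≠ 0)
    (hmem : ∀ w ∈ Metric.ball (0 : ℂ) 1, (ξ w, η w, ζ w) ∈ D.link) (hβ : ContinuousOn β U)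
    (hβU : ∀ w ∈ Metric.ball (0 : ℂ) 1, ∀ u : Circle, ∀ P : D.link,
      P.1 = D.spin u (ξ w, η w, ζ w) → P ∈ U ∧ β P = w)
    (hback : ∀ P ∈ U, β P ∈ Metric.ball (0 : ℂ) 1 →
      ‖P.1.1‖ = ‖ξ (β P)‖ ∧ ‖P.1.2.1‖ = ‖η (β P)‖ ∧ P.1.2.2 = ζ (β P)) :
    ∃ φ : OpenPartialHomeomorph (ℂ × Circle) D.link, φ.source = solidTorus ∧
      (∀ Q ∈ solidTorus, (φ Q : ℂ × ℂ × ℂ) = D.spin Q.2 (ξ Q.1, η Q.1, ζ Q.1)) ∧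
      IsFibredSolidTorus (Set.range D.orbit) φ := by
  obtain ⟨a, b, hab⟩ := D.exists_bezout
  set V : Set D.link := U ∩ β ⁻¹' Metric.ball 0 1 with hV
  have hVo : IsOpen V := hβ.isOpen_inter_preimage hU Metric.isOpen_ball
  let X : D.link → ℂ := fun P => P.1.1 / ξ (β P)
  let Y : D.link → ℂ := fun P => P.1.2.1 / η (β P)
  have hβV : ContinuousOn β V := hβ.mono Set.inter_subset_left
  have hXc : ContinuousOn X V :=
    ContinuousOn.div (by fun_prop) (hξ.comp hβV fun P hP => hP.2) fun P hP => hξ0 _ hP.2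
  have hYc : ContinuousOn Y V :=
    ContinuousOn.div (by fun_prop) (hη.comp hβV fun P hP => hP.2) fun P hP => hη0 _ hP.2
  have hXn : ∀ P ∈ V, ‖X P‖ = 1 := fun P hP => by
    simp only [X]
    rw [norm_div, (hback P hP.1 hP.2).1, div_self (norm_ne_zero_iff.2 (hξ0 _ hP.2))]
  have hYn : ∀ P ∈ V, ‖Y P‖ = 1 := fun P hP => by
    simp only [Y]
    rw [norm_div, (hback P hP.1 hP.2).2.1, div_self (norm_ne_zero_iff.2 (hη0 _ hP.2))]
  have hXY : ∀ P ∈ V, (X P ^ D.q * Y P ^ D.p) ^ D.g = 1 := fun P hP => by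
    have h1 := P.2.1
    have h2 := (hmem _ hP.2).1
    simp only at h2
    rw [(hback P hP.1 hP.2).2.2, h2] at h1
    have h3 := add_left_cancel h1
    rw [mul_pow, ← pow_mul, ← pow_mul, mul_comm D.q, mul_comm D.p, ← D.hk, ← D.hl]
    simp only [X, Y]
    rw [div_pow, div_pow, div_mul_div_comm, ← h3, div_self]
    exact mul_ne_zero (pow_ne_zero _ (hξ0 _ hP.2)) (pow_ne_zero _ (hη0 _ hP.2))
  -- among the finitely many values of `X ^ q * Y ^ p`, the value `1` is isolated
  set W : Set D.link := V ∩ (fun P => X P ^ D.q * Y P ^ D.p) ⁻¹' ({w : ℂ | w ^ D.g = 1} \ {1})ᶜ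
    with hW
  have hWo : IsOpen W := by
    refine ContinuousOn.isOpen_inter_preimage ((hXc.pow _).mul (hYc.pow _)) hVo ?_
    exact ((finite_pow_eq D.hg (1 : ℂ)).subset Set.sdiff_subset).isClosed.isOpen_compl
  have hW1 : ∀ P ∈ W, X P ^ D.q * Y P ^ D.p = 1 := fun P hP => by
    by_contra hne
    exact hP.2 ⟨hXY P hP.1, hne⟩
  let F : ℂ × Circle → ℂ × ℂ × ℂ := fun Q => D.spin Q.2 (ξ Q.1, η Q.1, ζ Q.1)
  let G : D.link → ℂ × Circle := fun P => (β P, toCircle (X P) ^ a * toCircle (Y P) ^ (-b))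
  have hFX : ∀ P : D.link, ∀ Q ∈ solidTorus, P.1 = F Q →
      P ∈ V ∧ β P = Q.1 ∧ X P = ((Q.2 ^ D.p : Circle) : ℂ) ∧
        Y P = (((Q.2 ^ D.q)⁻¹ : Circle) : ℂ) := by
    intro P Q hQ hPQ
    obtain ⟨h1, h2⟩ := hβU Q.1 hQ.1 Q.2 P hPQ
    refine ⟨⟨h1, by rw [Set.mem_preimage, h2]; exact hQ.1⟩, h2, ?_, ?_⟩
    · simp only [X, h2, hPQ, F, spin]
      rw [mul_div_cancel_right₀ _ (hξ0 _ hQ.1)]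
    · simp only [Y, h2, hPQ, F, spin]
      rw [mul_div_cancel_right₀ _ (hη0 _ hQ.1)]
  have hFc : ContinuousOn F solidTorus := by
    have c1 : ContinuousOn (fun Q : ℂ × Circle => ξ Q.1) solidTorus :=
      hξ.comp continuousOn_fst fun Q hQ => hQ.1
    have c2 : ContinuousOn (fun Q : ℂ × Circle => η Q.1) solidTorus :=
      hη.comp continuousOn_fst fun Q hQ => hQ.1
    have c3 : ContinuousOn (fun Q : ℂ × Circle => ζ Q.1) solidTorus :=
      hζ.comp continuousOn_fst fun Q hQ => hQ.1
    have c4 : Continuous fun Q : ℂ × Circle => ((Q.2 ^ D.p : Circle) : ℂ) :=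
      continuous_circle_coe.comp (continuous_snd.pow D.p)
    have c5 : Continuous fun Q : ℂ × Circle => (((Q.2 ^ D.q)⁻¹ : Circle) : ℂ) :=
      continuous_circle_coe.comp (continuous_snd.pow D.q).inv
    exact (c4.continuousOn.mul c1).prodMk ((c5.continuousOn.mul c2).prodMk c3)
  have key : ∃ φ : OpenPartialHomeomorph (ℂ × Circle) D.link, φ.source = solidTorus ∧
      ∀ Q ∈ solidTorus, (φ Q : ℂ × ℂ × ℂ) = F Q := by
    refine exists_tube_of_inverse (F := F) (U := W) (G := G) hWo hFc
      (fun Q hQ => D.spin_mem _ (hmem _ hQ.1)) ?_ ?_ ?_ ?_ ?_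
    · intro P Q hQ hPQ
      obtain ⟨h1, -, h3, h4⟩ := hFX P Q hQ hPQ
      refine ⟨h1, fun h => h.2 ?_⟩
      change X P ^ D.q * Y P ^ D.p = 1
      have h5 : (Q.2 ^ D.p) ^ D.q * ((Q.2 ^ D.q)⁻¹) ^ D.p = 1 := by
        rw [inv_pow, ← pow_mul, ← pow_mul, mul_comm D.p, mul_inv_cancel]
      rw [h3, h4, ← Circle.coe_pow, ← Circle.coe_pow _ D.p, ← Circle.coe_mul, h5, Circle.coe_one]
    · have c1 := continuousOn_toCircle (hXc.mono Set.inter_subset_left) fun P (hP : P ∈ W) =>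
        hXn P hP.1
      have c2 := continuousOn_toCircle (hYc.mono Set.inter_subset_left) fun P (hP : P ∈ W) =>
        hYn P hP.1
      exact (hβV.mono Set.inter_subset_left).prodMk ((c1.zpow a).mul (c2.zpow (-b)))
    · intro P hP
      exact ⟨hP.1.2, trivial⟩
    · intro P Q hQ hPQ
      obtain ⟨-, h2, h3, h4⟩ := hFX P Q hQ hPQ
      simp only [G, h2, h3, h4, toCircle_coe]
      rw [bezout_param_left hab]
    · intro P hP
      have h1 : toCircle (X P) ^ D.q * toCircle (Y P) ^ D.p = 1 := by
        apply Circle.ext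
        push_cast
        rw [coe_toCircle (hXn P hP.1), coe_toCircle (hYn P hP.1), hW1 P hP]
      obtain ⟨h2, h3⟩ := bezout_param hab h1
      simp only [F, G, spin]
      rw [h2, h3, coe_toCircle (hXn P hP.1), coe_toCircle (hYn P hP.1)]
      simp only [X, Y]
      rw [div_mul_cancel₀ _ (hξ0 _ hP.1.2), div_mul_cancel₀ _ (hη0 _ hP.1.2),
        ← (hback P hP.1.1 hP.1.2).2.2]
  obtain ⟨φ, hφ, hφF⟩ := key
  refine ⟨φ, hφ, hφF, isFibredSolidTorus_of_equivariant hφ hφF (p := 1) (q := 0) le_rfl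
    (by push_cast; exact isCoprime_one_left) fun Q hQ u => ?_⟩
  simp only [F, zpow_zero, Circle.coe_one, one_mul, pow_one]
  rw [spin_spin]

/-! ### Tubes on the side `|y| < α` -/

theorem contDiff_circleExp_pow (n : ℕ) :
    ContDiff ℝ ∞ fun R : ℂ × ℝ => ((Circle.exp R.2 ^ n : Circle) : ℂ) := by
  have h : (fun R : ℂ × ℝ => ((Circle.exp R.2 ^ n : Circle) : ℂ)) =
      fun R => Complex.exp (Complex.ofRealCLM R.2 * Complex.I) ^ n := by
    funext R
    rw [Circle.coe_pow, Circle.coe_exp]; rfl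
  rw [h]
  fun_prop

theorem contDiff_circleExp_pow_inv (n : ℕ) :
    ContDiff ℝ ∞ fun R : ℂ × ℝ => (((Circle.exp R.2 ^ n)⁻¹ : Circle) : ℂ) := by
  have h : (fun R : ℂ × ℝ => (((Circle.exp R.2 ^ n)⁻¹ : Circle) : ℂ)) =
      fun R => Complex.exp (Complex.ofRealCLM (-R.2) * Complex.I) ^ n := by
    funext R
    rw [← inv_pow, ← Circle.exp_neg, Circle.coe_pow, Circle.coe_exp]; rfl
  rw [h]
  fun_prop

theorem contDiffAt_spin {ξ η ζ : ℂ → ℂ} {Q : ℂ × ℝ} (hξ : ContDiffAt ℝ ∞ ξ Q.1)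
    (hη : ContDiffAt ℝ ∞ η Q.1) (hζ : ContDiffAt ℝ ∞ ζ Q.1) :
    ContDiffAt ℝ ∞ (fun R : ℂ × ℝ => D.spin (Circle.exp R.2) (ξ R.1, η R.1, ζ R.1)) Q := by
  have h1 := hξ.comp Q (contDiffAt_fst (𝕜 := ℝ) (n := ∞))
  have h2 := hη.comp Q (contDiffAt_fst (𝕜 := ℝ) (n := ∞))
  have h3 := hζ.comp Q (contDiffAt_fst (𝕜 := ℝ) (n := ∞))
  exact ((contDiff_circleExp_pow D.p).contDiffAt.mul h1).prodMk
    (((contDiff_circleExp_pow_inv D.q).contDiffAt.mul h2).prodMk h3)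

theorem coe_circleExp_pow (θ : ℝ) (n : ℕ) :
    ((Circle.exp θ ^ n : Circle) : ℂ) = Complex.exp (n * θ * Complex.I) := by
  rw [← Circle.exp_natCast_mul, Circle.coe_exp]
  push_cast; rfl

variable (D) in
theorem exists_core_radius : ∃ δ : ℝ, 0 < δ ∧ δ < D.α ∧ D.α ^ D.k * δ ^ D.l < ‖D.t‖ := by
  have hR : 0 < D.α ^ (D.k + D.l) := pow_pos D.hα _
  have ht : 0 < ‖D.t‖ := norm_pos_iff.2 D.ht0
  set τ := ‖D.t‖ / (2 * D.α ^ (D.k + D.l)) with hτ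
  have hτ0 : 0 < τ := by positivity
  have hτ1 : τ < 1 := by
    rw [hτ, div_lt_one (by positivity)]
    linarith [D.ht]
  refine ⟨D.α * τ, mul_pos D.hα hτ0, mul_lt_of_lt_one_right D.hα hτ1, ?_⟩
  calc D.α ^ D.k * (D.α * τ) ^ D.l = D.α ^ (D.k + D.l) * τ ^ D.l := by rw [mul_pow, pow_add]; ring
    _ ≤ D.α ^ (D.k + D.l) * τ := by
        gcongr
        exact pow_le_of_le_one hτ0.le hτ1.le D.l_ne_zero
    _ = ‖D.t‖ / 2 := by rw [hτ]; field_simp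
    _ < ‖D.t‖ := by linarith

/-- The tube around the leaf `{|x| = α, y = 0, z = c}`, `c ^ m = t`. It is of type `(p, -q)`. -/
theorem exists_exceptional_tube {P : D.link} (hy : P.1.2.1 = 0) :
    ∃ φ : OpenPartialHomeomorph (ℂ × Circle) D.link,
      IsFibredSolidTorus (Set.range D.orbit) φ ∧ D.IsSideAdapted φ ∧
        ∃ v, (0, v) ∈ φ.source ∧ φ (0, v) = P := by
  obtain ⟨⟨x, y, c⟩, hP⟩ := P
  simp only at hy
  subst hy
  have hx : ‖x‖ = D.α := D.norm_fst_of_lt hP (by simpa using D.hα)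
  have hc : c ^ D.m = D.t := by
    have := hP.1
    simpa [D.l_ne_zero] using this
  have hc0 : c ≠ 0 := by
    rintro rfl
    rw [zero_pow D.m_ne_zero] at hc
    exact D.ht0 hc.symm
  have hα0 : (D.α : ℂ) ≠ 0 := by exact_mod_cast D.hα.ne'
  have hαn : ∀ v : Circle, ‖(D.α : ℂ) * v‖ = D.α := fun v => by
    rw [norm_mul, Circle.norm_coe, mul_one, Complex.norm_real, Real.norm_of_nonneg D.hα.le]
  obtain ⟨δ, hδ0, hδα, hδ⟩ := D.exists_core_radius
  have hδ0' : (δ : ℂ) ≠ 0 := by exact_mod_cast hδ0.ne'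
  have hδn : ∀ w : ℂ, ‖w‖ < 1 → ‖(δ : ℂ) * w‖ < δ := fun w hw => by
    rw [norm_mul, Complex.norm_real, Real.norm_of_nonneg hδ0.le]
    exact mul_lt_of_lt_one_right hδ0 hw
  let F : ℂ × Circle → ℂ × ℂ × ℂ := fun Q => (D.α * Q.2, δ * Q.1,
    rootBranch D.m c (D.t + (D.α * Q.2) ^ D.k * (δ * Q.1) ^ D.l))
  have hslit : ∀ Q : ℂ × Circle, ‖Q.1‖ < 1 →
      (D.t + (D.α * Q.2) ^ D.k * (δ * Q.1) ^ D.l) / c ^ D.m ∈ Complex.slitPlane := by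
    intro Q hQ
    rw [hc, add_div, div_self D.ht0]
    apply one_add_mem_slitPlane
    rw [norm_div, div_lt_one (norm_pos_iff.2 D.ht0), norm_mul, norm_pow, norm_pow, hαn]
    refine lt_of_le_of_lt ?_ hδ
    have := D.hα.le
    gcongr
    exact (hδn _ hQ).le
  let U : Set D.link := {P | ‖P.1.2.1‖ < δ ∧ P.1.2.2 / c ∈ sector D.m}
  let G : D.link → ℂ × Circle := fun P => (P.1.2.1 / δ, toCircle (P.1.1 / D.α))
  have hUx : ∀ P ∈ U, ‖P.1.1‖ = D.α := fun P hP => D.norm_fst_of_lt P.2 (hP.1.trans hδα)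
  have hUx' : ∀ P ∈ U, ‖P.1.1 / (D.α : ℂ)‖ = 1 := fun P hP => by
    rw [norm_div, hUx P hP, Complex.norm_real, Real.norm_of_nonneg D.hα.le, div_self D.hα.ne']
  have key : ∃ φ : OpenPartialHomeomorph (ℂ × Circle) D.link, φ.source = solidTorus ∧
      ∀ Q ∈ solidTorus, (φ Q : ℂ × ℂ × ℂ) = F Q := by
    refine exists_tube_of_inverse (F := F) (U := U) (G := G) ?_ ?_ ?_ ?_ ?_ ?_ ?_ ?_
    · have h1 : Continuous fun P : D.link => ‖P.1.2.1‖ := by fun_prop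
      have h2 : Continuous fun P : D.link => P.1.2.2 / c := by fun_prop
      exact (isOpen_lt h1 continuous_const).inter ((isOpen_sector D.m).preimage h2)
    · have h1 : Continuous fun Q : ℂ × Circle => (Q.2 : ℂ) :=
        continuous_circle_coe.comp continuous_snd
      have h2 : ContinuousOn (fun Q : ℂ × Circle =>
          rootBranch D.m c (D.t + (D.α * Q.2) ^ D.k * (δ * Q.1) ^ D.l)) solidTorus := by
        intro Q hQ
        have h3 := (contDiffAt_rootBranch D.m (hslit Q (mem_solidTorus.1 hQ))).continuousAt
        have h4 : Continuous fun Q : ℂ × Circle =>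
          D.t + ((D.α : ℂ) * Q.2) ^ D.k * ((δ : ℂ) * Q.1) ^ D.l := by fun_prop
        exact (ContinuousAt.comp (f := fun Q : ℂ × Circle =>
          D.t + ((D.α : ℂ) * Q.2) ^ D.k * ((δ : ℂ) * Q.1) ^ D.l) h3
            h4.continuousAt).continuousWithinAt
      have h5 : Continuous fun Q : ℂ × Circle => (δ : ℂ) * Q.1 := by fun_prop
      exact (continuous_const.mul h1).continuousOn.prodMk (h5.continuousOn.prodMk h2)
    · intro Q hQ
      refine ⟨rootBranch_pow D.m_ne_zero hc0 _, ?_⟩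
      simp only [F, hαn]
      exact max_eq_left ((hδn _ (mem_solidTorus.1 hQ)).le.trans hδα.le)
    · intro P Q hQ hPQ
      have hQ' := mem_solidTorus.1 hQ
      simp only [U, Set.mem_ofPred_eq, hPQ, F]
      exact ⟨hδn _ hQ', rootBranch_mem_sector D.m_ne_zero hc0 (hslit Q hQ')⟩
    · refine ContinuousOn.prodMk (by fun_prop) (continuousOn_toCircle (by fun_prop) hUx')
    · intro P hP
      rw [mem_solidTorus]
      simp only [G, norm_div, Complex.norm_real, Real.norm_of_nonneg hδ0.le]
      rw [div_lt_one hδ0]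
      exact hP.1
    · intro P Q hQ hPQ
      simp only [G, hPQ, F]
      rw [mul_div_cancel_left₀ _ hδ0', mul_div_cancel_left₀ _ hα0, toCircle_coe]
    · intro P hP
      simp only [F, G]
      rw [coe_toCircle (hUx' P hP), mul_div_cancel₀ _ hα0, mul_div_cancel₀ _ hδ0', ← P.2.1,
        rootBranch_eq D.m_ne_zero hc0 hP.2]
  obtain ⟨φ, hφ, hφF⟩ := key
  refine ⟨φ, ?_, ?_, ?_⟩
  · refine isFibredSolidTorus_of_equivariant hφ hφF (p := D.p) (q := -D.q)
      (Nat.one_le_iff_ne_zero.2 D.hp) ?_ fun Q hQ u => ?_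
    · rw [IsCoprime.neg_right_iff]
      exact Nat.isCoprime_iff_coprime.2 D.hpq
    · have h := D.spin_pow_mul u (D.α * Q.2, δ * Q.1, 0)
      simp only [spin] at h
      simp only [F, spin, Circle.coe_mul, zpow_neg, zpow_natCast]
      rw [mul_left_comm (D.α : ℂ), mul_left_comm (δ : ℂ), h]
  · refine isSideAdapted_of_formula hφ hφF (fun R => F (torusLift R)) (fun R => rfl) hα0 one_ne_zero
      (fun R => ?_) (fun Q hQ => (hδn _ hQ).trans hδα) (fun Q hQ => ?_)
      (fun Q hQ hz => absurd hz ?_) (fun Q hQ _ => ⟨δ, hδ0', ?_⟩)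
    · simp only [F, torusLift]
      rw [Circle.coe_exp, Nat.cast_one, one_mul]
    · have h1 : ContDiff ℝ ∞ fun R : ℂ × ℝ => ((torusLift R).2 : ℂ) := by
        simpa [torusLift] using contDiff_circleExp_pow 1
      have h2 : ContDiff ℝ ∞ fun R : ℂ × ℝ => (torusLift R).1 := contDiff_fst
      have h3 : ContDiff ℝ ∞ fun R : ℂ × ℝ =>
          D.t + (D.α * ((torusLift R).2 : ℂ)) ^ D.k * (δ * (torusLift R).1) ^ D.l := by fun_prop
      have h4 := contDiffAt_rootBranch_comp D.m c h3.contDiffAt (hslit (torusLift Q) hQ)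
      exact (contDiff_const.mul h1).contDiffAt.prodMk
        ((contDiff_const.mul h2).contDiffAt.prodMk h4)
    · refine rootBranch_ne_zero D.m_ne_zero hc0 fun h => ?_
      have := hslit (torusLift Q) hQ
      rw [h, zero_div] at this
      exact Complex.zero_notMem_slitPlane this
    · simpa [F, torusLift] using (hasDerivAt_id Q.1).const_mul (δ : ℂ)
  · refine ⟨toCircle (x / D.α), by rw [hφ]; simp, Subtype.ext ?_⟩
    rw [hφF _ (by simp)]
    have hn : ‖x / (D.α : ℂ)‖ = 1 := by
      rw [norm_div, hx, Complex.norm_real, Real.norm_of_nonneg D.hα.le, div_self D.hα.ne']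
    simp only [F]
    rw [coe_toCircle hn, mul_div_cancel₀ _ hα0, mul_zero, zero_pow D.l_ne_zero, mul_zero, add_zero,
      ← hc, rootBranch_self _ hc0]

/-- The tube around a leaf with `|y| < α`, `y ≠ 0`: nearby leaves are parametrized by `z`, also where
`z = 0`. -/
theorem exists_side_tube {P : D.link} (hy0 : P.1.2.1 ≠ 0) (hy : ‖P.1.2.1‖ < D.α) :
    ∃ φ : OpenPartialHomeomorph (ℂ × Circle) D.link,
      IsFibredSolidTorus (Set.range D.orbit) φ ∧ D.IsSideAdapted φ ∧
        ∃ v, (0, v) ∈ φ.source ∧ φ (0, v) = P := by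
  obtain ⟨⟨x₀, y₀, c⟩, hP⟩ := P
  simp only at hy0 hy
  have hx : ‖x₀‖ = D.α := D.norm_fst_of_lt hP hy
  have hx0 : x₀ ≠ 0 := by rw [← norm_ne_zero_iff, hx]; exact D.hα.ne'
  have hxk : x₀ ^ D.k ≠ 0 := pow_ne_zero _ hx0
  have hyl : y₀ ^ D.l ≠ 0 := pow_ne_zero _ hy0
  have hc : c ^ D.m = D.t + x₀ ^ D.k * y₀ ^ D.l := hP.1
  have hc' : c ^ D.m - D.t = x₀ ^ D.k * y₀ ^ D.l := by rw [hc]; ring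
  let O : Set ℂ := {z | ‖z ^ D.m - D.t‖ < D.α ^ (D.k + D.l)} ∩
    (fun z => (z ^ D.m - D.t) / x₀ ^ D.k / y₀ ^ D.l) ⁻¹' Complex.slitPlane
  have hO : IsOpen O := (isOpen_lt (by fun_prop) continuous_const).inter
    (Complex.isOpen_slitPlane.preimage (by fun_prop))
  have hcO : c ∈ O := by
    refine ⟨?_, ?_⟩
    · rw [Set.mem_ofPred_eq, hc', norm_mul, norm_pow, norm_pow, hx, pow_add]
      have := D.hα
      gcongr
      exact D.l_ne_zero
    · simp only [Set.mem_preimage]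
      rw [hc', mul_div_cancel_left₀ _ hxk, div_self hyl]
      simp
  obtain ⟨δ, hδ0, hδ⟩ := Metric.isOpen_iff.1 hO c hcO
  have hδ0' : (δ : ℂ) ≠ 0 := by exact_mod_cast hδ0.ne'
  let ζ : ℂ → ℂ := fun w => c + δ * w
  have hζO : ∀ w : ℂ, ‖w‖ < 1 → ζ w ∈ O := fun w hw => hδ (by
    rw [mem_ball_iff_norm]
    simp only [ζ]
    rw [add_sub_cancel_left, norm_mul, Complex.norm_real, Real.norm_of_nonneg hδ0.le]
    exact mul_lt_of_lt_one_right hδ0 hw)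
  let η : ℂ → ℂ := fun w => rootBranch D.l y₀ ((ζ w ^ D.m - D.t) / x₀ ^ D.k)
  have hηl : ∀ w, η w ^ D.l = (ζ w ^ D.m - D.t) / x₀ ^ D.k := fun w =>
    rootBranch_pow D.l_ne_zero hy0 _
  have hηs : ∀ w, ‖w‖ < 1 → ContDiffAt ℂ ∞ η w := fun w hw => by
    have h1 : ContDiffAt ℂ ∞ (fun w => (ζ w ^ D.m - D.t) / x₀ ^ D.k) w := by
      simp only [ζ]; fun_prop
    exact contDiffAt_rootBranch_comp D.l y₀ h1 (hζO w hw).2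
  have hη0 : ∀ w, ‖w‖ < 1 → η w ≠ 0 := fun w hw => by
    refine rootBranch_ne_zero D.l_ne_zero hy0 fun h => ?_
    have h1 := (hζO w hw).2
    rw [Set.mem_preimage, h, zero_div] at h1
    exact Complex.zero_notMem_slitPlane h1
  have hηα : ∀ w, ‖w‖ < 1 → ‖η w‖ < D.α := fun w hw => by
    have h1 := (hζO w hw).1
    have h2 : x₀ ^ D.k * η w ^ D.l = ζ w ^ D.m - D.t := by rw [hηl, mul_div_cancel₀ _ hxk]
    rw [Set.mem_ofPred_eq, ← h2, norm_mul, norm_pow, norm_pow, hx, pow_add] at h1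
    exact lt_of_pow_lt_pow_left₀ _ D.hα.le (lt_of_mul_lt_mul_left h1 (pow_nonneg D.hα.le _))
  let β : D.link → ℂ := fun P => (P.1.2.2 - c) / δ
  let U : Set D.link := {P | ‖P.1.2.1‖ < D.α}
  have key : ∃ φ : OpenPartialHomeomorph (ℂ × Circle) D.link, φ.source = solidTorus ∧
      (∀ Q ∈ solidTorus, (φ Q : ℂ × ℂ × ℂ) = D.spin Q.2 (x₀, η Q.1, ζ Q.1)) ∧
      IsFibredSolidTorus (Set.range D.orbit) φ := by
    refine exists_regular_tube (ξ := fun _ => x₀) (β := β) (U := U)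
      (isOpen_lt (by fun_prop) continuous_const) continuousOn_const
      (fun w hw => (hηs w (mem_ball_zero_iff.1 hw)).continuousAt.continuousWithinAt)
      (by simp only [ζ]; fun_prop) (fun _ _ => hx0) (fun w hw => hη0 w (mem_ball_zero_iff.1 hw))
      (fun w hw => ⟨?_, ?_⟩) (by simp only [β]; fun_prop) (fun w hw u P hPw => ⟨?_, ?_⟩) ?_
    · simp only [hηl]
      rw [mul_div_cancel₀ _ hxk]; ring
    · simp only [hx]
      exact max_eq_left (hηα w (mem_ball_zero_iff.1 hw)).le
    · simp only [U, Set.mem_ofPred_eq]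
      rw [hPw, norm_spin_snd]
      exact hηα w (mem_ball_zero_iff.1 hw)
    · simp only [β, hPw, spin, ζ]
      rw [add_sub_cancel_left, mul_div_cancel_left₀ _ hδ0']
    · intro P hPU _
      have hPx := D.norm_fst_of_lt P.2 hPU
      have hz : P.1.2.2 = ζ (β P) := by
        simp only [ζ, β]
        rw [mul_div_cancel₀ _ hδ0']; ring
      refine ⟨hPx.trans hx.symm, ?_, hz⟩
      have h1 : P.1.1 ^ D.k * P.1.2.1 ^ D.l = x₀ ^ D.k * η (β P) ^ D.l := by
        rw [hηl, mul_div_cancel₀ _ hxk, ← hz, P.2.1]; ring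
      have h2 := congrArg norm h1
      rw [norm_mul, norm_mul, norm_pow, norm_pow, norm_pow, norm_pow, hPx, hx] at h2
      exact (pow_left_inj₀ (norm_nonneg _) (norm_nonneg _) D.l_ne_zero).1
        (mul_left_cancel₀ (pow_ne_zero _ D.hα.ne') h2)
  obtain ⟨φ, hφ, hφF, hfib⟩ := key
  refine ⟨φ, hfib, ?_, ?_⟩
  · have hζd : ∀ w, HasDerivAt ζ δ w := fun w => by
      simpa [ζ] using ((hasDerivAt_id w).const_mul (δ : ℂ)).const_add c
    refine isSideAdapted_of_formula hφ hφF
      (fun R => D.spin (Circle.exp R.2) (x₀, η R.1, ζ R.1)) (fun R => rfl) hx0 D.hp (fun R => ?_)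
      (fun Q hQ => ?_) (fun Q hQ => ?_) (fun Q hQ _ => ⟨δ, hδ0', hζd Q.1⟩) (fun Q hQ hz => ?_)
    · simp only [spin]
      rw [coe_circleExp_pow, mul_comm]
    · rw [norm_spin_snd]; exact hηα _ hQ
    · exact contDiffAt_spin contDiffAt_const ((hηs Q.1 hQ).restrict_scalars ℝ)
        (by simp only [ζ]; fun_prop)
    · have hηd := ((hηs Q.1 hQ).differentiableAt infty_ne_zero).hasDerivAt
      refine ⟨(((Circle.exp Q.2 ^ D.q)⁻¹ : Circle) : ℂ) * deriv η Q.1,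
        mul_ne_zero (Circle.coe_ne_zero _) fun h0 => ?_,
        hηd.const_mul (((Circle.exp Q.2 ^ D.q)⁻¹ : Circle) : ℂ)⟩
      -- differentiate `x₀ ^ k * η ^ l = ζ ^ m - t`
      rw [h0] at hηd
      have h1 := hηd.pow D.l
      have h2 := (((hζd Q.1).pow D.m).sub_const D.t).div_const (x₀ ^ D.k)
      have h3 : (η ^ D.l : ℂ → ℂ) = fun w => (ζ w ^ D.m - D.t) / x₀ ^ D.k := funext hηl
      rw [h3] at h1
      have h4 := h1.unique h2
      rw [mul_zero] at h4
      have hm0 : (D.m : ℂ) ≠ 0 := by exact_mod_cast D.m_ne_zero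
      have hz' : ζ Q.1 ≠ 0 := hz
      exact div_ne_zero (mul_ne_zero (mul_ne_zero hm0 (pow_ne_zero _ hz')) hδ0') hxk h4.symm
  · refine ⟨1, by rw [hφ]; simp, Subtype.ext ?_⟩
    rw [hφF _ (by simp), spin_one]
    simp only [η, ζ]
    rw [mul_zero, add_zero, hc', mul_div_cancel_left₀ _ hxk, rootBranch_self _ hy0]

/-! ### Tubes at the corner -/

/-- The `x`-coordinate of the cross-section at the corner, as a function of the transverse
coordinate `τ`: `|x|` stays equal to `|x₀|` for `Re τ ≤ 0` and decreases for `Re τ ≥ 0`. -/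
noncomputable def cornerX (x₀ τ : ℂ) : ℂ := x₀ * (Real.exp (-max τ.re 0) : ℝ)

/-- The `y`-coordinate of the cross-section at the corner: `|y|` increases to `|y₀|` for
`Re τ ≤ 0` and stays constant for `Re τ ≥ 0`; the argument grows by `Im τ`. -/
noncomputable def cornerY (y₀ τ : ℂ) : ℂ :=
  y₀ * Complex.exp ((min τ.re 0 : ℝ) + (τ.im : ℝ) * Complex.I)

theorem norm_cornerX (x₀ τ : ℂ) : ‖cornerX x₀ τ‖ = ‖x₀‖ * Real.exp (-max τ.re 0) := by
  rw [cornerX, norm_mul, Complex.norm_real, Real.norm_of_nonneg (Real.exp_pos _).le]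

theorem norm_cornerY (y₀ τ : ℂ) : ‖cornerY y₀ τ‖ = ‖y₀‖ * Real.exp (min τ.re 0) := by
  rw [cornerY, norm_mul, Complex.norm_exp]
  simp

theorem continuous_cornerX (x₀ : ℂ) : Continuous (cornerX x₀) := by
  have : Continuous fun τ : ℂ => Real.exp (-max τ.re 0) :=
    Real.continuous_exp.comp (Complex.continuous_re.max continuous_const).neg
  exact continuous_const.mul (Complex.continuous_ofReal.comp this)

theorem continuous_cornerY (y₀ : ℂ) : Continuous (cornerY y₀) := by
  have h : Continuous fun τ : ℂ => min τ.re 0 := Complex.continuous_re.min continuous_const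
  refine continuous_const.mul (Complex.continuous_exp.comp ?_)
  exact (Complex.continuous_ofReal.comp h).add
    ((Complex.continuous_ofReal.comp Complex.continuous_im).mul continuous_const)

theorem cornerX_pow_mul_cornerY_pow (x₀ y₀ τ : ℂ) (k l : ℕ) :
    cornerX x₀ τ ^ k * cornerY y₀ τ ^ l = x₀ ^ k * y₀ ^ l *
      Complex.exp ((l * min τ.re 0 - k * max τ.re 0 : ℝ) + (l * τ.im : ℝ) * Complex.I) := by
  rw [cornerX, cornerY, mul_pow, mul_pow, mul_mul_mul_comm, Complex.ofReal_exp, ← Complex.exp_nat_mul,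
    ← Complex.exp_nat_mul, ← Complex.exp_add]
  congr 2
  push_cast
  ring

theorem arg_exp_of_abs_lt {z : ℂ} (h : |z.im| < Real.pi) : (Complex.exp z).arg = z.im := by
  have := abs_lt.1 h
  rw [Complex.arg_exp, toIocMod_eq_self]
  constructor <;> linarith

theorem exp_mem_slitPlane {z : ℂ} (h : |z.im| < Real.pi) : Complex.exp z ∈ Complex.slitPlane := by
  rw [Complex.mem_slitPlane_iff_arg, arg_exp_of_abs_lt h]
  exact ⟨(abs_lt.1 h).2.ne, Complex.exp_ne_zero _⟩

/-- Where `max |x| |y| = r`, the ratio `|y / x|` determines `|x|` and `|y|`; the cross-section realizes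
the ratio `exp (Re τ)`. -/
theorem norm_eq_corner {x₀ y₀ x y τ : ℂ} {r : ℝ} (hr : 0 < r) (hx₀ : ‖x₀‖ = r) (hy₀ : ‖y₀‖ = r)
    (hx : x ≠ 0) (hy : y ≠ 0) (hmax : max ‖x‖ ‖y‖ = r)
    (hτ : τ.re = Real.log ‖y‖ - Real.log ‖x‖) :
    ‖x‖ = ‖cornerX x₀ τ‖ ∧ ‖y‖ = ‖cornerY y₀ τ‖ := by
  have hxn := norm_pos_iff.2 hx
  have hyn := norm_pos_iff.2 hy
  rw [norm_cornerX, norm_cornerY, hx₀, hy₀]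
  rcases le_total ‖x‖ ‖y‖ with h | h
  · rw [max_eq_right h] at hmax
    have h0 : 0 ≤ τ.re := by rw [hτ, sub_nonneg]; exact Real.log_le_log hxn h
    rw [max_eq_left h0, min_eq_right h0, hτ, neg_sub, Real.exp_sub, Real.exp_log hxn,
      Real.exp_log hyn, Real.exp_zero, hmax]
    exact ⟨by field_simp, by ring⟩
  · rw [max_eq_left h] at hmax
    have h0 : τ.re ≤ 0 := by rw [hτ, sub_nonpos]; exact Real.log_le_log hyn h
    rw [max_eq_right h0, min_eq_left h0, hτ, neg_zero, Real.exp_sub, Real.exp_log hxn,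
      Real.exp_log hyn, Real.exp_zero, hmax]
    exact ⟨by ring, by field_simp⟩

/-- The angle `δ Im w - n θ`, as a linear function of `(w, θ)`. -/
noncomputable def angleL (δ : ℝ) (n : ℕ) : ℂ × ℝ →L[ℝ] ℝ :=
  δ • Complex.imCLM.comp (ContinuousLinearMap.fst ℝ ℂ ℝ) - (n : ℝ) • ContinuousLinearMap.snd ℝ ℂ ℝ

theorem angleL_apply (δ : ℝ) (n : ℕ) (R : ℂ × ℝ) : angleL δ n R = δ * R.1.im - n * R.2 := by
  simp [angleL]

theorem hasFDerivAt_sin_sub (N : ℂ × ℝ →L[ℝ] ℝ) (Q : ℂ × ℝ) :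
    HasFDerivAt (fun R => Real.sin (N (R - Q))) N Q := by
  have h : HasFDerivAt (fun R => N (R - Q)) N Q := by
    have := N.hasFDerivAt.comp Q ((hasFDerivAt_id Q).sub_const Q)
    rwa [ContinuousLinearMap.comp_id] at this
  simpa using h.sin

/-- The Jacobian criterion for a corner tube on the side `|y| = α`, `|x| < α`. -/
theorem det_sideFrame_flip_pos {Φ : ℂ × ℝ → ℂ × ℂ × ℂ} {Q : ℂ × ℝ} (hΦ : ContDiffAt ℝ ∞ Φ Q)
    (hz : (Φ Q).2.2 ≠ 0) {x₀ y₀ : ℂ} (hx₀ : x₀ ≠ 0) (hy₀ : y₀ ≠ 0) {δ : ℝ} (hδ : 0 < δ) {p q : ℕ}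
    (hp : p ≠ 0)
    (hx : ∀ R, (Φ R).1 = x₀ * Complex.exp ((-δ * R.1.re : ℝ) + (p * R.2 : ℝ) * Complex.I))
    (hy : ∀ R, (Φ R).2.1 = y₀ * Complex.exp ((δ * R.1.im - q * R.2 : ℝ) * Complex.I)) :
    0 < (((sideFrame (flip (Φ Q))).comp flipL).comp (fderiv ℝ Φ Q)).det := by
  have hd := (hΦ.differentiableAt infty_ne_zero).hasFDerivAt
  have hL := ((sideFrame (flip (Φ Q))).comp flipL).hasFDerivAt (x := Φ Q) |>.comp Q hd
  let M : ℂ × ℝ →L[ℝ] ℂ :=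
    Complex.ofRealCLM.comp ((-δ) • Complex.reCLM.comp (ContinuousLinearMap.fst ℝ ℂ ℝ)) +
      ((p : ℝ) • ContinuousLinearMap.snd ℝ ℂ ℝ).smulRight Complex.I
  have hM : ∀ R, M R = (-δ * R.1.re : ℝ) + (p * R.2 : ℝ) * Complex.I := fun R => by
    simp [M]
  have h2 : HasFDerivAt (fun R : ℂ × ℝ => (x₀ * Complex.exp (M R),
      Complex.normSq y₀ * Real.sin (angleL δ q (R - Q))))
      ((x₀ • (Complex.exp (M Q) • M)).prod (Complex.normSq y₀ • angleL δ q)) Q :=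
    (M.hasFDerivAt.cexp.const_mul x₀).prodMk ((hasFDerivAt_sin_sub (angleL δ q) Q).const_mul _)
  have hfun : (((sideFrame (flip (Φ Q))).comp flipL) ∘ Φ) = fun R : ℂ × ℝ =>
      (x₀ * Complex.exp (M R), Complex.normSq y₀ * Real.sin (angleL δ q (R - Q))) := by
    funext R
    have e1 : starRingEnd ℂ (Φ Q).2.1 * (Φ R).2.1 =
        (Complex.normSq y₀ : ℂ) * Complex.exp ((angleL δ q (R - Q) : ℝ) * Complex.I) := by
      rw [hy, hy, map_mul, ← Complex.exp_conj, Complex.normSq_eq_conj_mul_self, mul_mul_mul_comm,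
        ← Complex.exp_add, angleL_apply]
      congr 2
      simp
      ring
    rw [Function.comp, ContinuousLinearMap.comp_apply, flipL_apply, sideFrame_apply]
    simp only [flip, if_neg hz, e1, hx, hM]
    rw [Complex.im_ofReal_mul, Complex.exp_ofReal_mul_I_im]
  rw [hfun] at hL
  have hLe := hL.unique h2
  obtain ⟨X, hX⟩ : ∃ X : ℂ, X = x₀ * Complex.exp (M Q) := ⟨_, rfl⟩
  have hX0 : 0 < X.re * X.re + X.im * X.im := by
    have : 0 < Complex.normSq X :=
      Complex.normSq_pos.2 (hX ▸ mul_ne_zero hx₀ (Complex.exp_ne_zero _))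
    rwa [Complex.normSq_apply] at this
  have hev : ∀ R, ((x₀ • (Complex.exp (M Q) • M)).prod (Complex.normSq y₀ • angleL δ q)) R =
      (X * ((-δ * R.1.re : ℝ) + (p * R.2 : ℝ) * Complex.I),
        Complex.normSq y₀ * (δ * R.1.im - q * R.2)) := fun R => by
    rw [hX, ← hM, ← angleL_apply]
    simp [mul_assoc]
  have hp' : (0 : ℝ) < p := by positivity
  have hy' := Complex.normSq_pos.2 hy₀
  rw [hLe, det_prod_complex_real, Matrix.det_fin_three]
  simp only [hev]
  have := mul_pos (mul_pos (mul_pos hδ hδ) (mul_pos hp' hy')) hX0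
  simp
  linarith

/-- The Jacobian criterion for a corner tube at the corner: in the corner chart it is, up to a
factor, `(w, θ) ↦ (δ Re w + i sin (δ Im w - q θ), sin (p θ))`. -/
theorem cornerChart_criterion {Φ : ℂ × ℝ → ℂ × ℂ × ℂ} {Q : ℂ × ℝ} {δ : ℝ} (hδ : 0 < δ) {p q : ℕ}
    (hp : p ≠ 0)
    (h : ∀ R, D.cornerChart (Φ Q) (Φ R) = (((δ * R.1.re : ℝ) : ℂ) +
      (Real.sin (angleL δ q (R - Q)) : ℂ) * Complex.I, Real.sin (p * (R.2 - Q.2)) / D.α)) :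
    ContDiffAt ℝ ∞ (fun R => D.cornerChart (Φ Q) (Φ R)) Q ∧
      0 < (fderiv ℝ (fun R => D.cornerChart (Φ Q) (Φ R)) Q).det := by
  simp only [h]
  have hp' : (0 : ℝ) < p := by positivity
  let T : ℂ × ℝ →L[ℝ] ℝ := (p : ℝ) • ContinuousLinearMap.snd ℝ ℂ ℝ
  have hT : ∀ R : ℂ × ℝ, Real.sin (p * (R.2 - Q.2)) / D.α = D.α⁻¹ * Real.sin (T (R - Q)) :=
    fun R => by simp [T]; ring
  let S : ℂ × ℝ →L[ℝ] ℂ := Complex.ofRealCLM.comp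
    (δ • Complex.reCLM.comp (ContinuousLinearMap.fst ℝ ℂ ℝ))
  have hS : ∀ R : ℂ × ℝ, S R = ((δ * R.1.re : ℝ) : ℂ) := fun R => by simp [S]
  simp only [hT, ← hS]
  have hsmooth : ContDiff ℝ ∞ fun R : ℂ × ℝ => (S R +
      (Complex.ofRealCLM (Real.sin (angleL δ q (R - Q)))) * Complex.I,
      D.α⁻¹ * Real.sin (T (R - Q))) := by fun_prop
  have hder : HasFDerivAt (fun R : ℂ × ℝ => (S R +
      (Complex.ofRealCLM (Real.sin (angleL δ q (R - Q)))) * Complex.I,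
      D.α⁻¹ * Real.sin (T (R - Q))))
      ((S + Complex.I • Complex.ofRealCLM.comp (angleL δ q)).prod (D.α⁻¹ • T)) Q := by
    have h1 := (Complex.ofRealCLM.hasFDerivAt.comp Q (hasFDerivAt_sin_sub (angleL δ q) Q)).mul_const
      Complex.I
    exact (S.hasFDerivAt.add h1).prodMk ((hasFDerivAt_sin_sub T Q).const_mul D.α⁻¹)
  refine ⟨hsmooth.contDiffAt, ?_⟩
  have e : (fun R : ℂ × ℝ => (S R + (Real.sin (angleL δ q (R - Q)) : ℂ) * Complex.I,
      D.α⁻¹ * Real.sin (T (R - Q)))) = (fun R : ℂ × ℝ => (S R +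
      (Complex.ofRealCLM (Real.sin (angleL δ q (R - Q)))) * Complex.I,
      D.α⁻¹ * Real.sin (T (R - Q)))) := rfl
  rw [e, hder.fderiv]
  refine det_pos_of_complex_slice _ (a := δ) (by exact_mod_cast hδ.ne')
    (mul_pos (inv_pos.2 D.hα) hp') (fun w => ?_) ?_
  · simp [S, T, angleL, Complex.ext_iff]
  · simp [T]

theorem cornerChart_polar {x₀ y₀ z z' : ℂ} (hx₀ : ‖x₀‖ = D.α) (hy₀ : ‖y₀‖ = D.α)
    (a b a' b' r s : ℝ) :
    D.cornerChart (x₀ * Complex.exp (a * Complex.I), y₀ * Complex.exp (b * Complex.I), z)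
      (x₀ * (Real.exp r : ℝ) * Complex.exp (a' * Complex.I),
        y₀ * (Real.exp s : ℝ) * Complex.exp (b' * Complex.I), z') =
      (((s - r : ℝ) : ℂ) + (Real.sin (b' - b) : ℂ) * Complex.I, Real.sin (a' - a) / D.α) := by
  have hα := D.hα
  have hα0 : (D.α : ℂ) ≠ 0 := by exact_mod_cast hα.ne'
  have hx0 : x₀ ≠ 0 := by rw [← norm_ne_zero_iff, hx₀]; exact hα.ne'
  have hy0 : y₀ ≠ 0 := by rw [← norm_ne_zero_iff, hy₀]; exact hα.ne'
  have hn : ∀ (v : ℂ) (e θ : ℝ), ‖v‖ = D.α →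
      ‖v * (Real.exp e : ℝ) * Complex.exp (θ * Complex.I)‖ = D.α * Real.exp e := fun v e θ hv => by
    rw [norm_mul, norm_mul, Complex.norm_exp_ofReal_mul_I, hv, Complex.norm_real,
      Real.norm_of_nonneg (Real.exp_pos _).le, mul_one]
  have hq : ∀ (v : ℂ) (e θ θ' : ℝ), v ≠ 0 → v * (Real.exp e : ℝ) * Complex.exp (θ' * Complex.I) /
      ((D.α * Real.exp e : ℝ) : ℂ) / (v * Complex.exp (θ * Complex.I)) =
      ((D.α⁻¹ : ℝ) : ℂ) * Complex.exp ((θ' - θ : ℝ) * Complex.I) := fun v e θ θ' hv => by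
    have he : (Real.exp e : ℂ) ≠ 0 := by exact_mod_cast (Real.exp_pos e).ne'
    rw [Complex.ofReal_sub, sub_mul, Complex.exp_sub, Complex.ofReal_mul, Complex.ofReal_inv]
    have := Complex.exp_ne_zero (θ * Complex.I)
    field_simp
  simp only [cornerChart]
  rw [hn x₀ r a' hx₀, hn y₀ s b' hy₀, hq x₀ r a a' hx0, hq y₀ s b b' hy0]
  simp only [Complex.im_ofReal_mul, Complex.exp_ofReal_mul_I_im]
  rw [mul_inv_cancel_left₀ hα.ne', Real.log_mul hα.ne' (Real.exp_pos _).ne',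
    Real.log_mul hα.ne' (Real.exp_pos _).ne', Real.log_exp, Real.log_exp, inv_mul_eq_div,
    add_sub_add_left_eq_sub]

/-- The orbits of a cross-section `(ξ, η)`, with `z` the branch of the root near `c`. -/
noncomputable def sectionSpin (D : Params) (c : ℂ) (ξ η : ℂ → ℂ) (Q : ℂ × Circle) : ℂ × ℂ × ℂ :=
  D.spin Q.2 (ξ Q.1, η Q.1, rootBranch D.m c (D.t + ξ Q.1 ^ D.k * η Q.1 ^ D.l))

theorem contDiffAt_sectionSpin {c : ℂ} {ξ η : ℂ → ℂ} {Q : ℂ × ℝ} (hξ : ContDiffAt ℝ ∞ ξ Q.1)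
    (hη : ContDiffAt ℝ ∞ η Q.1)
    (hs : (D.t + ξ Q.1 ^ D.k * η Q.1 ^ D.l) / c ^ D.m ∈ Complex.slitPlane) :
    ContDiffAt ℝ ∞ (fun R => D.sectionSpin c ξ η (torusLift R)) Q := by
  have h : ContDiffAt ℝ ∞ (fun w => D.t + ξ w ^ D.k * η w ^ D.l) Q.1 := by fun_prop
  exact contDiffAt_spin hξ hη (contDiffAt_rootBranch_comp D.m c h hs)

theorem sectionSpin_congr {c : ℂ} {ξ η ξ' η' : ℂ → ℂ} {Q : ℂ × ℝ} (hξ : ξ =ᶠ[𝓝 Q.1] ξ')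
    (hη : η =ᶠ[𝓝 Q.1] η') : (fun R => D.sectionSpin c ξ η (torusLift R)) =ᶠ[𝓝 Q]
      fun R => D.sectionSpin c ξ' η' (torusLift R) := by
  filter_upwards [continuous_fst.continuousAt.eventually hξ,
    continuous_fst.continuousAt.eventually hη] with R h1 h2
  simp only [sectionSpin, torusLift]
  rw [h1, h2]

theorem circleExp_pow_mul (θ : ℝ) (n : ℕ) (x : ℂ) :
    ((Circle.exp θ ^ n : Circle) : ℂ) * x = x * Complex.exp ((n * θ : ℝ) * Complex.I) := by
  rw [coe_circleExp_pow, mul_comm]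
  push_cast
  rfl

theorem circleExp_pow_inv_mul (θ : ℝ) (n : ℕ) (y : ℂ) :
    (((Circle.exp θ ^ n)⁻¹ : Circle) : ℂ) * y = y * Complex.exp ((-(n * θ) : ℝ) * Complex.I) := by
  rw [← inv_pow, ← Circle.exp_neg, coe_circleExp_pow, mul_comm]
  push_cast
  congr 2
  ring

/-- A tube given by the corner cross-section is adapted. -/
theorem isAdapted_corner {x₀ y₀ c : ℂ} {δ : ℝ} (hx₀ : ‖x₀‖ = D.α) (hy₀ : ‖y₀‖ = D.α) (hc : c ≠ 0)
    (hδ : 0 < δ)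
    (hs : ∀ w : ℂ, ‖w‖ < 1 →
      (D.t + cornerX x₀ (δ * w) ^ D.k * cornerY y₀ (δ * w) ^ D.l) / c ^ D.m ∈ Complex.slitPlane)
    {φ : OpenPartialHomeomorph (ℂ × Circle) D.link} (hφ : φ.source = solidTorus)
    (hφF : ∀ Q ∈ solidTorus, (φ Q : ℂ × ℂ × ℂ) =
      D.sectionSpin c (fun w => cornerX x₀ (δ * w)) (fun w => cornerY y₀ (δ * w)) Q) :
    D.IsAdapted φ := by
  have hα := D.hα
  have hx0 : x₀ ≠ 0 := by rw [← norm_ne_zero_iff, hx₀]; exact hα.ne'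
  have hy0 : y₀ ≠ 0 := by rw [← norm_ne_zero_iff, hy₀]; exact hα.ne'
  have hre : ∀ w : ℂ, ((δ : ℂ) * w).re = δ * w.re := fun w => Complex.re_ofReal_mul _ _
  have him : ∀ w : ℂ, ((δ : ℂ) * w).im = δ * w.im := fun w => Complex.im_ofReal_mul _ _
  have hnx : ∀ Q ∈ solidTorus, ‖(φ Q).1.1‖ = D.α * Real.exp (-max (δ * Q.1.re) 0) :=
    fun Q hQ => by rw [hφF Q hQ, sectionSpin, norm_spin_fst, norm_cornerX, hx₀, hre]
  have hny : ∀ Q ∈ solidTorus, ‖(φ Q).1.2.1‖ = D.α * Real.exp (min (δ * Q.1.re) 0) :=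
    fun Q hQ => by rw [hφF Q hQ, sectionSpin, norm_spin_snd, norm_cornerY, hy₀, hre]
  have hcorner : ∀ Q ∈ solidTorus, (‖(φ Q).1.1‖ = D.α ∧ ‖(φ Q).1.2.1‖ = D.α) ↔ Q.1.re = 0 := by
    intro Q hQ
    rw [hnx Q hQ, hny Q hQ, mul_eq_left₀ hα.ne', mul_eq_left₀ hα.ne', Real.exp_eq_one_iff,
      Real.exp_eq_one_iff, neg_eq_zero, max_eq_right_iff, min_eq_right_iff, ← le_antisymm_iff,
      mul_eq_zero, or_iff_right hδ.ne']
  have hznz : ∀ w : ℂ, ‖w‖ < 1 → rootBranch D.m c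
      (D.t + cornerX x₀ (δ * w) ^ D.k * cornerY y₀ (δ * w) ^ D.l) ≠ 0 := fun w hw => by
    refine rootBranch_ne_zero D.m_ne_zero hc fun h => ?_
    have := hs w hw
    rw [h, zero_div] at this
    exact Complex.zero_notMem_slitPlane this
  -- off the corner, one of `|x|` and `|y|` is locally constant along the cross-section
  have hside : ∀ Q, torusLift Q ∈ φ.source →
      ¬ (‖(φ (torusLift Q)).1.1‖ = D.α ∧ ‖(φ (torusLift Q)).1.2.1‖ = D.α) →
      ContDiffAt ℝ ∞ (fun R => (φ (torusLift R) : ℂ × ℂ × ℂ)) Q ∧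
      0 < ((D.frame (φ (torusLift Q))).comp
        (fderiv ℝ (fun R => (φ (torusLift R) : ℂ × ℂ × ℂ)) Q)).det := by
    intro Q hQ hQc
    have he := eventuallyEq_lift hφ hφF hQ
    have hQ' : torusLift Q ∈ solidTorus := hφ ▸ hQ
    have hQ1 : ‖Q.1‖ < 1 := mem_solidTorus.1 hQ'
    have hsQ := hs Q.1 hQ1
    have hzQ := hznz Q.1 hQ1
    rw [hcorner _ hQ'] at hQc
    change ¬ Q.1.re = 0 at hQc
    rcases lt_or_gt_of_ne hQc with hneg | hpos
    · have hev : ∀ᶠ w : ℂ in 𝓝 Q.1, δ * w.re < 0 := by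
        refine (continuous_const.mul Complex.continuous_re).continuousAt.eventually_lt
          continuousAt_const ?_
        exact mul_neg_of_pos_of_neg hδ hneg
      have eX : (fun w => cornerX x₀ (δ * w)) =ᶠ[𝓝 Q.1] fun _ => x₀ := by
        filter_upwards [hev] with w hw
        rw [cornerX, hre, max_eq_right hw.le]; simp
      have eY : (fun w => cornerY y₀ (δ * w)) =ᶠ[𝓝 Q.1] fun w => y₀ * Complex.exp (δ * w) := by
        filter_upwards [hev] with w hw
        rw [cornerY, min_eq_left ((hre w).symm ▸ hw.le : ((δ : ℂ) * w).re ≤ 0), Complex.re_add_im]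
      have he' := he.trans (sectionSpin_congr eX eY)
      rw [eX.eq_of_nhds, eY.eq_of_nhds] at hsQ hzQ
      have hsm := contDiffAt_sectionSpin (D := D) (Q := Q) (c := c) (ξ := fun _ => x₀)
        (η := fun w => y₀ * Complex.exp (δ * w)) contDiffAt_const (by fun_prop) hsQ
      refine ⟨hsm.congr_of_eventuallyEq he', ?_⟩
      have hlt : ‖(φ (torusLift Q)).1.2.1‖ < D.α := by
        rw [hny _ hQ']
        refine mul_lt_of_lt_one_right hα (Real.exp_lt_one_iff.2 ?_)
        exact min_lt_of_left_lt (mul_neg_of_pos_of_neg hδ hneg)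
      rw [frame, if_pos hlt, he'.fderiv_eq (𝕜 := ℝ), he'.eq_of_nhds]
      have hd : HasDerivAt (fun w => y₀ * Complex.exp (δ * w))
          (y₀ * (Complex.exp (δ * Q.1) * δ)) Q.1 := by
        have := ((hasDerivAt_id Q.1).const_mul (δ : ℂ)).cexp.const_mul y₀
        simpa using this
      have hd' := hd.const_mul (((Circle.exp Q.2 ^ D.q)⁻¹ : Circle) : ℂ)
      refine det_sideFrame_pos_of_ne (Q := Q) (Φ := fun R => D.sectionSpin c (fun _ => x₀)
        (fun w => y₀ * Complex.exp (δ * w)) (torusLift R)) hsm hx0 D.hp (fun R => ?_) hzQ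
        (mul_ne_zero (Circle.coe_ne_zero _) (mul_ne_zero hy0
          (mul_ne_zero (Complex.exp_ne_zero _) (by exact_mod_cast hδ.ne')))) hd'
      simp only [sectionSpin, spin, torusLift]
      rw [coe_circleExp_pow, mul_comm]
    · have hev : ∀ᶠ w : ℂ in 𝓝 Q.1, 0 < δ * w.re := by
        refine continuousAt_const.eventually_lt
          (continuous_const.mul Complex.continuous_re).continuousAt ?_
        exact mul_pos hδ hpos
      have eX : (fun w => cornerX x₀ (δ * w)) =ᶠ[𝓝 Q.1]
          fun w => x₀ * Complex.exp (Complex.ofRealCLM (-δ * w.re)) := by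
        filter_upwards [hev] with w hw
        rw [cornerX, hre, max_eq_left hw.le, Complex.ofReal_exp, neg_mul]; rfl
      have eY : (fun w => cornerY y₀ (δ * w)) =ᶠ[𝓝 Q.1]
          fun w => y₀ * Complex.exp (Complex.ofRealCLM (δ * w.im) * Complex.I) := by
        filter_upwards [hev] with w hw
        rw [cornerY, hre, him, min_eq_right hw.le, Complex.ofReal_zero, zero_add]; rfl
      have he' := he.trans (sectionSpin_congr eX eY)
      rw [eX.eq_of_nhds, eY.eq_of_nhds] at hsQ hzQ
      have hcre : ContDiff ℝ ∞ Complex.re := Complex.reCLM.contDiff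
      have hcim : ContDiff ℝ ∞ Complex.im := Complex.imCLM.contDiff
      have hsm := contDiffAt_sectionSpin (D := D) (Q := Q) (c := c)
        (ξ := fun w => x₀ * Complex.exp (Complex.ofRealCLM (-δ * w.re)))
        (η := fun w => y₀ * Complex.exp (Complex.ofRealCLM (δ * w.im) * Complex.I))
        (ContDiff.contDiffAt (by fun_prop)) (ContDiff.contDiffAt (by fun_prop)) hsQ
      refine ⟨hsm.congr_of_eventuallyEq he', ?_⟩
      have hlt : ¬ ‖(φ (torusLift Q)).1.2.1‖ < D.α := by
        rw [hny _ hQ', min_eq_right (show 0 ≤ δ * (torusLift Q).1.re from (mul_pos hδ hpos).le)]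
        simp
      rw [frame, if_neg hlt, he'.fderiv_eq (𝕜 := ℝ), he'.eq_of_nhds]
      refine det_sideFrame_flip_pos (Q := Q) (Φ := fun R => D.sectionSpin c
        (fun w => x₀ * Complex.exp (Complex.ofRealCLM (-δ * w.re)))
        (fun w => y₀ * Complex.exp (Complex.ofRealCLM (δ * w.im) * Complex.I)) (torusLift R)) hsm hzQ hx0 hy0 hδ D.hp (q := D.q) (fun R => ?_) (fun R => ?_)
      · simp only [sectionSpin, spin, torusLift]
        rw [circleExp_pow_mul, mul_assoc, ← Complex.exp_add]
        rfl
      · simp only [sectionSpin, spin, torusLift]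
        rw [circleExp_pow_inv_mul, mul_assoc, ← Complex.exp_add]
        simp only [Complex.ofRealCLM_apply]
        push_cast
        ring_nf
  refine ⟨fun Q hQ hQc => (hside Q hQ hQc).1, fun Q hQ hQc => (hside Q hQ hQc).2,
    fun Q hQ hQc => ?_⟩
  have he := eventuallyEq_lift hφ hφF hQ
  have hQ' : torusLift Q ∈ solidTorus := hφ ▸ hQ
  rw [hcorner _ hQ'] at hQc
  change Q.1.re = 0 at hQc
  have he' := he.fun_comp (D.cornerChart (φ (torusLift Q)))
  simp only [Function.comp_def] at he'
  rw [he.eq_of_nhds] at he' ⊢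
  have hsec : ∀ R : ℂ × ℝ, D.sectionSpin c (fun w => cornerX x₀ (δ * w))
      (fun w => cornerY y₀ (δ * w)) (torusLift R) =
      (x₀ * (Real.exp (-max (δ * R.1.re) 0) : ℝ) * Complex.exp ((D.p * R.2 : ℝ) * Complex.I),
        y₀ * (Real.exp (min (δ * R.1.re) 0) : ℝ) *
          Complex.exp ((δ * R.1.im - D.q * R.2 : ℝ) * Complex.I),
        rootBranch D.m c (D.t + cornerX x₀ (δ * R.1) ^ D.k * cornerY y₀ (δ * R.1) ^ D.l)) := by
    intro R
    simp only [sectionSpin, spin, torusLift]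
    rw [circleExp_pow_mul, circleExp_pow_inv_mul]
    refine Prod.ext ?_ (Prod.ext ?_ rfl)
    · simp only [cornerX, hre]
    · simp only [cornerY, hre, him]
      rw [mul_assoc, mul_assoc, ← Complex.exp_add, Complex.ofReal_exp, ← Complex.exp_add]
      push_cast
      ring_nf
  have hcrit := cornerChart_criterion (D := D) (Q := Q) (δ := δ) (p := D.p) (q := D.q)
    (Φ := fun R => D.sectionSpin c (fun w => cornerX x₀ (δ * w))
      (fun w => cornerY y₀ (δ * w)) (torusLift R)) hδ D.hp fun R => ?_
  · refine ⟨hcrit.1.congr_of_eventuallyEq he', ?_⟩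
    rw [he'.fderiv_eq (𝕜 := ℝ)]
    exact hcrit.2
  · have hQ0 : δ * Q.1.re = 0 := by rw [hQc, mul_zero]
    have hmm : min (δ * R.1.re) 0 - -max (δ * R.1.re) 0 = δ * R.1.re := by
      rw [sub_neg_eq_add, min_add_max, add_zero]
    simp only [hsec]
    rw [hQ0, max_self, min_self, neg_zero, Real.exp_zero, Complex.ofReal_one, mul_one, mul_one,
      cornerChart_polar hx₀ hy₀, hmm, angleL_apply]
    simp only [Prod.fst_sub, Prod.snd_sub, Complex.sub_im]
    congr 3
    · congr 2; ring
    · ring_nf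

/-- The tube around a corner leaf. Nearby leaves are parametrized by `log |y / x|` and by the
argument of `x ^ k * y ^ l`. -/
theorem exists_corner_tube {P : D.link} (hx : ‖P.1.1‖ = D.α) (hy : ‖P.1.2.1‖ = D.α) :
    ∃ φ : OpenPartialHomeomorph (ℂ × Circle) D.link,
      IsFibredSolidTorus (Set.range D.orbit) φ ∧ D.IsAdapted φ ∧
        ∃ v, (0, v) ∈ φ.source ∧ φ (0, v) = P := by
  obtain ⟨⟨x₀, y₀, c⟩, hP⟩ := P
  simp only at hx hy
  have hα := D.hα
  have hx0 : x₀ ≠ 0 := by rw [← norm_ne_zero_iff, hx]; exact hα.ne'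
  have hy0 : y₀ ≠ 0 := by rw [← norm_ne_zero_iff, hy]; exact hα.ne'
  have hcm : c ^ D.m = D.t + x₀ ^ D.k * y₀ ^ D.l := hP.1
  set s₀ := x₀ ^ D.k * y₀ ^ D.l with hs₀
  have hs₀0 : s₀ ≠ 0 := mul_ne_zero (pow_ne_zero _ hx0) (pow_ne_zero _ hy0)
  have hcm0 : c ^ D.m ≠ 0 := by
    intro h
    rw [h] at hcm
    have h1 : ‖s₀‖ = ‖D.t‖ := by rw [eq_neg_of_add_eq_zero_right hcm.symm, norm_neg]
    rw [hs₀, D.norm_pow_mul_of_corner hx hy] at h1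
    exact D.ht.ne' h1
  have hc : c ≠ 0 := fun h => hcm0 (by rw [h, zero_pow D.m_ne_zero])
  have hX0 : cornerX x₀ 0 = x₀ := by simp [cornerX]
  have hY0 : cornerY y₀ 0 = y₀ := by simp [cornerY]
  have hcX := continuous_cornerX x₀
  have hcY := continuous_cornerY y₀
  -- the radius is so small that the branches of the root and of the argument are defined
  let O : Set ℂ := (fun τ => (D.t + cornerX x₀ τ ^ D.k * cornerY y₀ τ ^ D.l) / c ^ D.m) ⁻¹'
    Complex.slitPlane
  have hO : IsOpen O := Complex.isOpen_slitPlane.preimage (by fun_prop)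
  have h0O : (0 : ℂ) ∈ O := by
    simp only [O, Set.mem_preimage, hX0, hY0]
    rw [← hs₀, ← hcm, div_self hcm0]
    simp
  obtain ⟨δ', hδ'0, hδ'⟩ := Metric.isOpen_iff.1 hO 0 h0O
  have hl : (0 : ℝ) < D.l := by exact_mod_cast Nat.pos_of_ne_zero D.l_ne_zero
  set δ := min δ' (Real.pi / D.l) with hδdef
  have hδ : 0 < δ := lt_min hδ'0 (div_pos Real.pi_pos hl)
  have hδ0' : (δ : ℂ) ≠ 0 := by exact_mod_cast hδ.ne'
  have hτ : ∀ w : ℂ, ‖w‖ < 1 → ‖(δ : ℂ) * w‖ < δ := fun w hw => by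
    rw [norm_mul, Complex.norm_real, Real.norm_of_nonneg hδ.le]
    exact mul_lt_of_lt_one_right hδ hw
  have hs : ∀ w : ℂ, ‖w‖ < 1 →
      (D.t + cornerX x₀ (δ * w) ^ D.k * cornerY y₀ (δ * w) ^ D.l) / c ^ D.m ∈ Complex.slitPlane :=
    fun w hw => hδ' (mem_ball_zero_iff.2 ((hτ w hw).trans_le (min_le_left _ _)))
  have him : ∀ w : ℂ, ‖w‖ < 1 → |D.l * ((δ : ℂ) * w).im| < Real.pi := fun w hw => by
    rw [abs_mul, Nat.abs_cast, mul_comm]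
    refine (lt_div_iff₀ hl).1 ?_
    exact (Complex.abs_im_le_norm _).trans_lt ((hτ w hw).trans_le (min_le_right _ _))
  have hquot : ∀ τ, cornerX x₀ τ ^ D.k * cornerY y₀ τ ^ D.l / s₀ =
      Complex.exp ((D.l * min τ.re 0 - D.k * max τ.re 0 : ℝ) + (D.l * τ.im : ℝ) * Complex.I) :=
    fun τ => by rw [cornerX_pow_mul_cornerY_pow, ← hs₀, mul_div_cancel_left₀ _ hs₀0]
  have hexpim : ∀ a b : ℝ, ((a : ℂ) + (b : ℂ) * Complex.I).im = b := fun a b => by simp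
  let ξ : ℂ → ℂ := fun w => cornerX x₀ (δ * w)
  let η : ℂ → ℂ := fun w => cornerY y₀ (δ * w)
  have hξ0 : ∀ w, ξ w ≠ 0 := fun w => by
    rw [← norm_ne_zero_iff, norm_cornerX, hx]
    exact (mul_pos hα (Real.exp_pos _)).ne'
  have hη0 : ∀ w, η w ≠ 0 := fun w => by
    rw [← norm_ne_zero_iff, norm_cornerY, hy]
    exact (mul_pos hα (Real.exp_pos _)).ne'
  let ζ : ℂ → ℂ := fun w => rootBranch D.m c (D.t + ξ w ^ D.k * η w ^ D.l)
  let σ : D.link → ℂ := fun P => P.1.1 ^ D.k * P.1.2.1 ^ D.l / s₀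
  let U : Set D.link := {P | P.1.1 ≠ 0} ∩ ({P | P.1.2.1 ≠ 0} ∩
    (σ ⁻¹' Complex.slitPlane ∩ (fun P : D.link => P.1.2.2 / c) ⁻¹' sector D.m))
  have hσ : Continuous σ := by fun_prop
  have hU : IsOpen U := by
    refine (isOpen_ne_fun (by fun_prop) continuous_const).inter
      ((isOpen_ne_fun (by fun_prop) continuous_const).inter
        ((Complex.isOpen_slitPlane.preimage hσ).inter ((isOpen_sector D.m).preimage ?_)))
    fun_prop
  let β : D.link → ℂ := fun P =>
    (((Real.log ‖P.1.2.1‖ - Real.log ‖P.1.1‖ : ℝ) : ℂ) +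
      ((σ P).arg / D.l : ℝ) * Complex.I) / δ
  have hδβ : ∀ P, (δ : ℂ) * β P = ((Real.log ‖P.1.2.1‖ - Real.log ‖P.1.1‖ : ℝ) : ℂ) +
      ((σ P).arg / D.l : ℝ) * Complex.I := fun P => mul_div_cancel₀ _ hδ0'
  have hβ : ContinuousOn β U := by
    intro P hP
    have c1 : ContinuousAt (fun P : D.link => Real.log ‖P.1.2.1‖) P :=
      ContinuousAt.log (by fun_prop) (norm_ne_zero_iff.2 hP.2.1)
    have c2 : ContinuousAt (fun P : D.link => Real.log ‖P.1.1‖) P :=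
      ContinuousAt.log (by fun_prop) (norm_ne_zero_iff.2 hP.1)
    have c3 : ContinuousAt (fun P => (σ P).arg) P :=
      ContinuousAt.comp (g := Complex.arg) (Complex.continuousAt_arg hP.2.2.1) hσ.continuousAt
    have c4 := Complex.continuous_ofReal.continuousAt.comp (c1.sub c2)
    have c5 := Complex.continuous_ofReal.continuousAt.comp (c3.div_const (D.l : ℝ))
    exact ((c4.add (c5.mul continuousAt_const)).div_const _).continuousWithinAt
  have key : ∃ φ : OpenPartialHomeomorph (ℂ × Circle) D.link, φ.source = solidTorus ∧
      (∀ Q ∈ solidTorus, (φ Q : ℂ × ℂ × ℂ) = D.spin Q.2 (ξ Q.1, η Q.1, ζ Q.1)) ∧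
      IsFibredSolidTorus (Set.range D.orbit) φ := by
    refine exists_regular_tube (β := β) hU (by fun_prop) (by fun_prop) ?_ (fun w _ => hξ0 w)
      (fun w _ => hη0 w) (fun w hw => ⟨rootBranch_pow D.m_ne_zero hc _, ?_⟩) hβ
      (fun w hw u P hPw => ?_) ?_
    · intro w hw
      have h1 := (contDiffAt_rootBranch D.m (hs w (mem_ball_zero_iff.1 hw))).continuousAt
      have h2 : Continuous fun w => D.t + ξ w ^ D.k * η w ^ D.l := by fun_prop
      exact (ContinuousAt.comp (f := fun w => D.t + ξ w ^ D.k * η w ^ D.l) h1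
        h2.continuousAt).continuousWithinAt
    · simp only [ξ, η]
      rw [norm_cornerX, norm_cornerY, hx, hy]
      rcases le_total ((δ : ℂ) * w).re 0 with h | h
      · rw [max_eq_right h, min_eq_left h, neg_zero, Real.exp_zero, mul_one]
        exact max_eq_left (mul_le_of_le_one_right hα.le (Real.exp_le_one_iff.2 h))
      · rw [max_eq_left h, min_eq_right h, Real.exp_zero, mul_one]
        exact max_eq_right (mul_le_of_le_one_right hα.le
          (Real.exp_le_one_iff.2 (neg_nonpos.2 h)))
    · have hw1 := mem_ball_zero_iff.1 hw
      have hn1 : ‖P.1.1‖ = ‖ξ w‖ := by rw [hPw, norm_spin_fst]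
      have hn2 : ‖P.1.2.1‖ = ‖η w‖ := by rw [hPw, norm_spin_snd]
      have hσP : σ P = Complex.exp ((D.l * min ((δ : ℂ) * w).re 0 -
          D.k * max ((δ : ℂ) * w).re 0 : ℝ) + (D.l * ((δ : ℂ) * w).im : ℝ) * Complex.I) := by
        simp only [σ]
        rw [hPw, spin_pow_mul]
        exact hquot _
      refine ⟨⟨?_, ?_, ?_, ?_⟩, ?_⟩
      · exact norm_ne_zero_iff.1 (hn1 ▸ norm_ne_zero_iff.2 (hξ0 w))
      · exact norm_ne_zero_iff.1 (hn2 ▸ norm_ne_zero_iff.2 (hη0 w))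
      · rw [Set.mem_preimage, hσP]
        exact exp_mem_slitPlane (by rw [hexpim]; exact him w hw1)
      · rw [Set.mem_preimage, hPw]
        exact rootBranch_mem_sector D.m_ne_zero hc (hs w hw1)
      · apply mul_left_cancel₀ hδ0'
        rw [hδβ, hσP, arg_exp_of_abs_lt (by rw [hexpim]; exact him w hw1), hexpim,
          mul_div_cancel_left₀ _ hl.ne', hn1, hn2]
        simp only [ξ, η]
        rw [norm_cornerX, norm_cornerY, hx, hy, Real.log_mul hα.ne' (Real.exp_pos _).ne',
          Real.log_mul hα.ne' (Real.exp_pos _).ne', Real.log_exp, Real.log_exp,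
          add_sub_add_left_eq_sub, sub_neg_eq_add, min_add_max, add_zero, Complex.re_add_im]
    · intro P hPU hβP
      have hw1 := mem_ball_zero_iff.1 hβP
      have hre : ((δ : ℂ) * β P).re = Real.log ‖P.1.2.1‖ - Real.log ‖P.1.1‖ := by
        rw [hδβ]; simp
      have himβ : D.l * ((δ : ℂ) * β P).im = (σ P).arg := by
        rw [hδβ, hexpim, mul_div_cancel₀ _ hl.ne']
      obtain ⟨hn1, hn2⟩ := norm_eq_corner hα hx hy hPU.1 hPU.2.1 P.2.2 hre
      have hprod : P.1.1 ^ D.k * P.1.2.1 ^ D.l = ξ (β P) ^ D.k * η (β P) ^ D.l := by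
        refine (div_left_inj' hs₀0).1 (Complex.ext_norm_arg ?_ ?_)
        · simp only [norm_div, norm_mul, norm_pow, hn1, hn2, ξ, η]
        · simp only [ξ, η]
          rw [hquot, arg_exp_of_abs_lt (by rw [hexpim]; exact him _ hw1), hexpim, himβ]
      refine ⟨hn1, hn2, ?_⟩
      simp only [ζ]
      rw [← hprod, ← P.2.1, rootBranch_eq D.m_ne_zero hc hPU.2.2.2]
  obtain ⟨φ, hφ, hφF, hfib⟩ := key
  refine ⟨φ, hfib, isAdapted_corner hx hy hc hδ hs hφ hφF, 1, by rw [hφ]; simp, Subtype.ext ?_⟩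
  rw [hφF _ (by simp), spin_one]
  simp only [ζ, ξ, η]
  rw [mul_zero, hX0, hY0, ← hs₀, ← hcm, rootBranch_self _ hc]

/-! ### The Seifert structure -/

theorem exists_side_tube_of_lt {P : D.link} (hy : ‖P.1.2.1‖ < D.α) :
    ∃ φ : OpenPartialHomeomorph (ℂ × Circle) D.link,
      IsFibredSolidTorus (Set.range D.orbit) φ ∧ D.IsSideAdapted φ ∧
        ∃ v, (0, v) ∈ φ.source ∧ φ (0, v) = P := by
  by_cases hy0 : P.1.2.1 = 0
  · exact exists_exceptional_tube hy0
  · exact exists_side_tube hy0 hy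

theorem exists_tube (P : D.link) :
    ∃ φ : OpenPartialHomeomorph (ℂ × Circle) D.link,
      IsFibredSolidTorus (Set.range D.orbit) φ ∧ D.IsAdapted φ ∧
        ∃ v, (0, v) ∈ φ.source ∧ φ (0, v) = P := by
  rcases lt_or_eq_of_le (D.norm_snd_le P.2) with hy | hy
  · obtain ⟨φ, h1, h2, h3⟩ := exists_side_tube_of_lt hy
    exact ⟨φ, h1, h2.isAdapted, h3⟩
  rcases lt_or_eq_of_le (D.norm_fst_le P.2) with hx | hx
  · obtain ⟨φ, h1, h2, v, h3, h4⟩ :=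
      exists_side_tube_of_lt (D := D.swap) (P := D.flipHomeo.symm P) hx
    refine ⟨φ.transHomeomorph D.flipHomeo, isFibredSolidTorus_flip h1, h2.isAdapted_flip, v, h3, ?_⟩
    change D.flipHomeo (φ (0, v)) = P
    rw [h4, Homeomorph.apply_symm_apply]
  · exact exists_corner_tube hx hy

variable (D)

/-- The Seifert structure of the link. Its leaves are the orbits of the circle action, and its
tubes are all adapted fibred solid tori. -/
noncomputable def seifertStructure : SeifertStructure D.link where
  leaves := Set.range D.orbit
  tubes := {φ | IsFibredSolidTorus (Set.range D.orbit) φ ∧ D.IsAdapted φ}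
  compact := isCompact_iff_compactSpace.1 D.isCompact_link
  hausdorff := inferInstance
  connected := isConnected_iff_connectedSpace.1 D.isConnected_link
  partition := D.isPartition_orbits
  fibred _ hφ := hφ.1
  core := by
    rintro _ ⟨P, rfl⟩
    obtain ⟨φ, h1, h2, v, hv, hP⟩ := exists_tube P
    refine ⟨φ, ⟨h1, h2⟩, ?_⟩
    obtain ⟨-, p, q, hp, -, hleaf⟩ := h1
    obtain ⟨R, hR⟩ := hleaf _ hv
    rw [modelLeaf_core (Nat.one_le_iff_ne_zero.1 hp)] at hR
    rw [← hR]
    have hPR : P ∈ D.orbit R := by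
      rw [hR]
      exact ⟨(0, v), by simp, hP⟩
    exact (D.orbit_eq_of_mem hPR).symm
  compatible _ hφ _ hψ := hφ.2.compatible D hψ.2

theorem milnorBoundary_eq_link {ε : ℝ} (hαε : D.α ≤ ε)
    (htε : D.α ^ (D.k + D.l) + ‖D.t‖ < ε ^ D.m) :
    milnorBoundary D.m D.k D.l D.α ε D.t = D.link := by
  have hα := D.hα
  have hε : 0 < ε := hα.trans_le hαε
  ext ⟨x, y, z⟩
  simp only [milnorBoundary, milnorFibre, polydisc, frontier_prod_eq, hirzebruchFun, link,
    frontier_closedBall _ hα.ne', frontier_closedBall _ hε.ne', Metric.isClosed_closedBall.closure_eq,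
    Metric.isClosed_closedBall.prod Metric.isClosed_closedBall |>.closure_eq,
    Set.mem_inter_iff, Set.mem_union, Set.mem_prod, Set.mem_preimage, Set.mem_singleton_iff,
    mem_closedBall_zero_iff, mem_sphere_zero_iff_norm, Set.mem_ofPred_eq, sub_eq_iff_eq_add]
  -- on the fibre over `t` one has `|z| < ε`
  have hz : z ^ D.m = D.t + x ^ D.k * y ^ D.l → ‖x‖ ≤ D.α → ‖y‖ ≤ D.α → ‖z‖ < ε := by
    intro h hx hy
    refine lt_of_pow_lt_pow_left₀ D.m hε.le (lt_of_le_of_lt ?_ htε)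
    rw [← norm_pow, h, add_comm (D.α ^ _)]
    refine (norm_add_le _ _).trans ?_
    gcongr
    rw [norm_mul, norm_pow, norm_pow, pow_add]
    gcongr
  constructor
  · rintro ⟨⟨⟨hx, hy, hzε⟩, hf⟩, h⟩
    refine ⟨hf, le_antisymm (max_le hx hy) ?_⟩
    rcases h with ⟨-, ⟨-, h⟩ | ⟨h, -⟩⟩ | ⟨h, -⟩
    · exact absurd h (hz hf hx hy).ne
    · exact h ▸ le_max_right _ _
    · exact h ▸ le_max_left _ _
  · rintro ⟨hf, hmax⟩
    have hx : ‖x‖ ≤ D.α := hmax ▸ le_max_left _ _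
    have hy : ‖y‖ ≤ D.α := hmax ▸ le_max_right _ _
    have hzε := (hz hf hx hy).le
    refine ⟨⟨⟨hx, hy, hzε⟩, hf⟩, ?_⟩
    rcases max_choice ‖x‖ ‖y‖ with h | h
    · exact Or.inr ⟨h ▸ hmax, hy, hzε⟩
    · exact Or.inl ⟨hx, Or.inr ⟨h ▸ hmax, hzε⟩⟩

end Params

end HirzebruchLink

theorem theorem3p1 (m k l : ℕ) (hm : 2 ≤ m) (hk : 1 ≤ k) (hkl : k ≤ l)
    (hgcd : Nat.gcd m (Nat.gcd k l) = 1)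
    (α ε : ℝ) (hα : 0 < α) (hαε : α ≤ ε) (hpoly : α ^ (k + l) < ε ^ m)
    (t : ℂ) (ht0 : t ≠ 0) (ht : ‖t‖ < α ^ (k + l)) (htε : α ^ (k + l) + ‖t‖ < ε ^ m) :
    -- the boundary lies in `{|x| = α} ∪ {|y| = α}`
    (∀ P ∈ milnorBoundary m k l α ε t, ‖P.1‖ = α ∨ ‖P.2.1‖ = α) ∧
    ∃ S : SeifertStructure (milnorBoundary m k l α ε t),
      -- away from the corner `|x| = |y| = α`, the smooth structure is the one induced by `ℂ³`
      (∀ φ ∈ S.tubes, ∀ Q : ℂ × ℝ, torusLift Q ∈ φ.source →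
        ¬ (‖(φ (torusLift Q)).1.1‖ = α ∧ ‖(φ (torusLift Q)).1.2.1‖ = α) →
          ContDiffAt ℝ ∞ (fun R : ℂ × ℝ => (φ (torusLift R) : ℂ × ℂ × ℂ)) Q ∧
          Function.Injective
            (fderiv ℝ (fun R : ℂ × ℝ => (φ (torusLift R) : ℂ × ℂ × ℂ)) Q)) ∧
      -- the projection to the `z`-axis is constant on each leaf
      (∀ F ∈ S.leaves, ∃ c : ℂ, ∀ P ∈ F, P.1.2.2 = c) ∧
      -- the leaves are the connected components of the level sets `L ∩ {z = c}`
      S.leaves = Set.range fun P : milnorBoundary m k l α ε t =>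
        connectedComponentIn (zLevel P) P := by
  have hg : 0 < Nat.gcd k l := Nat.gcd_pos_of_pos_left l hk
  let D : HirzebruchLink.Params :=
    { m := m, k := k, l := l, g := Nat.gcd k l, p := l / Nat.gcd k l, q := k / Nat.gcd k l
      α := α, t := t, hm := hm, hg := hg.ne'
      hp := (Nat.div_pos (Nat.le_of_dvd (by omega) (Nat.gcd_dvd_right k l)) hg).ne'
      hq := (Nat.div_pos (Nat.le_of_dvd hk (Nat.gcd_dvd_left k l)) hg).ne'
      hk := (Nat.mul_div_cancel' (Nat.gcd_dvd_left k l)).symm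
      hl := (Nat.mul_div_cancel' (Nat.gcd_dvd_right k l)).symm
      hpq := (Nat.coprime_div_gcd_div_gcd hg).symm
      hgcd := hgcd, hα := hα, ht0 := ht0, ht := ht }
  have hL : milnorBoundary m k l α ε t = D.link := D.milnorBoundary_eq_link hαε htε
  rw [hL]
  refine ⟨fun P hP => D.norm_eq_or hP, D.seifertStructure, fun φ hφ Q hQ hc =>
    ⟨hφ.2.contDiffAt Q hQ hc, hφ.2.injective_fderiv D hQ hc⟩, ?_, ?_⟩
  · rintro _ ⟨P, rfl⟩
    refine ⟨P.1.2.2, ?_⟩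
    rintro Q ⟨u, hu⟩
    rw [hu]
    rfl
  · exact congrArg Set.range (funext fun P => (D.connectedComponentIn_zLevel P).symm)
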